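/- **Floortile instances.** A Floortile instance consists of a finite rectangular grid of tiles, finitely many robots standing on pairwise different tiles, each with a brush configured to black or white, and a rectangular part of the grid (the goal tiles) that has to be painted in a black/white chessboard pattern; the other tiles are called normal. Initially some goal tiles, but no normal tiles, may already be painted, and no robot stands on a painted tile. A tile is clear iff it is not painted and no robot is on it. The actions are: a robot moves to a horizontally or vertically adjacent clear tile; a robot paints a clear tile directly above or below its own tile in the color of its brush (the tile is then painted and no longer clear); a robot changes the color of its brush. The states of the planning problem are the truth valuations of its ground atoms "robot $a$ is at tile $t$", "robot $a$ has color $c$", "tile $t$ is clear", "tile $t$ is painted in color $c$", and the goal states are those in which all goal tiles are painted in their prescribed colors. Let $\mathcal Q$ be the class of all instances that are solvable and in which the normal tiles are pairwise connected (any two of them are joined by a path of adjacent normal tiles). **Width.** An optimal plan for a set of states is a shortest action sequence leading from the initial state into it; an optimal plan for a tuple of atoms is one for the set of states in which these atoms are true. The width of an unsolvable problem is its number of atoms, and the width of a problem solvable in at most one step is $0$. Otherwise it is the least $k$ for which there are tuples $t_0,\dots,t_m$ of at most $k$ atoms each such that $t_0$ is true in the initial state, every optimal plan for $t_i$ can be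 extended by a single action to an optimal plan for $t_{i+1}$ ($0\le i<m$), and every optimal plan for $t_m$ is an optimal plan for the problem. **Sketch.** For a state $s$ let $g(s)$ be the number of goal tiles that are not painted in their prescribed color (the unpainted goal tiles), and let $v(s)$ be true iff for each unpainted goal tile $\tau_1$ there are tiles $\tau_1,\dots,\tau_n$, each directly above its predecessor or each directly below its predecessor, such that $\tau_1,\dots,\tau_{n-1}$ are unpainted goal tiles and $\tau_n$ is normal. The sketch $R$ over the features $\{g,v\}$ has the single rule $r=\{v,\,g>0\}\mapsto\{g{\downarrow}\}$. Thus the set $G_r(s)$ of subgoal states is $\{s' : g(s')<g(s),\ v(s')=v(s)\}$ if $v(s)$ holds and $g(s)>0$, and is empty otherwise. The $R$-reachable states of an instance $P$ are the initial state and, recursively, for each $R$-reachable $s$ the states in $G_r(s)$ that are reachable from $s$ with the fewest actions. For such $s$, $P[s]$ is $P$ with initial state $s$ and with the states in $G_r(s)$ added to the goal states. A sketch is *terminating* if on each infinite path of its sketch graph some numerical feature is decreased infinitely often and possibly increased only finitely often; the sketch graph has as nodes the valuations of the Boolean features and of the expressions $n=0$ for the numerical features $n$, and has an edge labeled by a rule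 from one node to another iff some pair of feature valuations over these nodes satisfies the rule. **Theorem.** The sketch $R$ is well-formed for $\mathcal Q$, that is, 1. its features separate the goals: there is a single set $B$ of Boolean feature valuations (truth values of $v$ and of $g=0$) such that for each $P\in\mathcal Q$, a state $s$ of $P$ is a goal state iff the Boolean feature valuation of $s$ is in $B$; and 2. it is terminating. Moreover, the sketch has width $2$ over $\mathcal Q$: the maximum of the widths of the subproblems $P[s]$, over all $P\in\mathcal Q$ and all $R$-reachable states $s$ of $P$, is $2$. In particular each such $P[s]$ has width at most $2$. -/

import Mathlib

/-! ## Classical planning problems, plans and width -/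

/-- A grounded classical planning problem. A state is a truth valuation of the ground atoms, given
by the set of atoms that it makes true. The goal is an arbitrary set of states. -/
structure PlanningProblem where
  Atom : Type
  Act : Type
  pre : Act → Set Atom
  add : Act → Set Atom
  del : Act → Set Atom
  init : Set Atom
  goal : Set (Set Atom)

namespace PlanningProblem

/-- States are truth valuations of the atoms. -/
abbrev State (P : PlanningProblem) : Type := Set P.Atom

/-- The successor state `f(a, s)`. -/
def result (P : PlanningProblem) (a : P.Act) (s : P.State) : P.State :=
  (s \ P.del a) ∪ P.add a

/-- The action sequence `π` is executable in `s` and leads to `s'`. -/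
def Leads (P : PlanningProblem) : P.State → List P.Act → P.State → Prop
  | s, [], s' => s' = s
  | s, a :: π, s' => P.pre a ⊆ s ∧ P.Leads (P.result a s) π s'

/-- `π` is a plan from state `s` to the set of states `G`. -/
def IsPlan (P : PlanningProblem) (s : P.State) (G : Set P.State) (π : List P.Act) : Prop :=
  ∃ s' ∈ G, P.Leads s π s'

/-- `π` is a shortest plan from state `s` to the set of states `G`. -/
def IsOptimalPlan (P : PlanningProblem) (s : P.State) (G : Set P.State) (π : List P.Act) : Prop :=
  P.IsPlan s G π ∧ ∀ π' : List P.Act, P.IsPlan s G π' → π.length ≤ π'.length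

/-- The problem has a plan. -/
def Solvable (P : PlanningProblem) : Prop := ∃ π, P.IsPlan P.init P.goal π

/-- `π` is an optimal plan for the atom tuple `t`. -/
def IsOptimalPlanFor (P : PlanningProblem) (t : Finset P.Atom) (π : List P.Act) : Prop :=
  P.IsOptimalPlan P.init {s | ∀ p ∈ t, p ∈ s} π

/-- `t 0, …, t m` is an admissible chain of atom tuples. -/
def IsAdmissibleChain (P : PlanningProblem) (m : ℕ) (t : ℕ → Finset P.Atom) : Prop :=
  (∀ p ∈ t 0, p ∈ P.init) ∧
  (∀ i < m, ∀ π, P.IsOptimalPlanFor (t i) π → ∃ a, P.IsOptimalPlanFor (t (i + 1)) (π ++ [a])) ∧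
  (∀ π, P.IsOptimalPlanFor (t m) π → P.IsOptimalPlan P.init P.goal π)

open Classical in
/-- The width of a problem: the number of atoms if the problem is unsolvable, `0` if it is solvable
in at most one step, and else the least size of an admissible chain. -/
noncomputable def width (P : PlanningProblem) : ℕ∞ :=
  if ¬ P.Solvable then ENat.card P.Atom
  else if ∃ π, P.IsPlan P.init P.goal π ∧ π.length ≤ 1 then 0
  else sInf {w : ℕ∞ | ∃ k : ℕ, w = k ∧
    ∃ (m : ℕ) (t : ℕ → Finset P.Atom), P.IsAdmissibleChain m t ∧ ∀ i ≤ m, (t i).card ≤ k}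

end PlanningProblem

/-! ## Features and sketches

`B` and `N` are the sets of (names of) Boolean and numerical features. -/

namespace Sketch

/-- A feature valuation. -/
structure Valuation (B N : Type) where
  bool : B → Prop
  num : N → ℕ

/-- A Boolean feature valuation: the values of the expressions `p` and `n = 0`. -/
structure BoolValuation (B N : Type) where
  bool : B → Prop
  isZero : N → Prop

/-- The Boolean feature valuation `b(f)` determined by `f`. -/
def Valuation.toBool {B N : Type} (f : Valuation B N) : BoolValuation B N :=
  ⟨f.bool, fun n => f.num n = 0⟩

/-- Feature conditions `p`, `¬ p`, `n = 0`, `n > 0`. -/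
inductive Cond (B N : Type)
  | pos (p : B)
  | neg (p : B)
  | eqZero (n : N)
  | gtZero (n : N)

/-- Feature effects `p`, `¬ p`, `p?`, `n↓`, `n↑`, `n?`. -/
inductive Effect (B N : Type)
  | pos (p : B)
  | neg (p : B)
  | anyBool (p : B)
  | dec (n : N)
  | inc (n : N)
  | anyNum (n : N)

/-- A sketch rule `C ↦ E`. -/
structure Rule (B N : Type) where
  cond : Set (Cond B N)
  eff : Set (Effect B N)

variable {B N : Type}

/-- Truth of a condition in a feature valuation. -/
def Cond.Holds (f : Valuation B N) : Cond B N → Prop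
  | .pos p => f.bool p
  | .neg p => ¬ f.bool p
  | .eqZero n => f.num n = 0
  | .gtZero n => 0 < f.num n

/-- A pair of feature valuations complies with an effect. -/
def Effect.Holds (f f' : Valuation B N) : Effect B N → Prop
  | .pos p => f'.bool p
  | .neg p => ¬ f'.bool p
  | .anyBool _ => True
  | .dec n => f'.num n < f.num n
  | .inc n => f.num n < f'.num n
  | .anyNum _ => True

/-- The pair `(f, f')` satisfies the sketch rule `r`; features that do not occur in the effects
keep their value. -/
def Rule.Satisfies (r : Rule B N) (f f' : Valuation B N) : Prop :=
  (∀ c ∈ r.cond, c.Holds f) ∧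
  (∀ e ∈ r.eff, e.Holds f f') ∧
  (∀ p : B, Effect.pos p ∉ r.eff → Effect.neg p ∉ r.eff → Effect.anyBool p ∉ r.eff →
    (f'.bool p ↔ f.bool p)) ∧
  (∀ n : N, Effect.dec n ∉ r.eff → Effect.inc n ∉ r.eff → Effect.anyNum n ∉ r.eff →
    f'.num n = f.num n)

/-- The sketch graph, whose nodes are the Boolean feature valuations: it has an edge from `b` to `b'`
labeled by the rule `r` if some pair of valuations over `b` and `b'` satisfies `r`. -/
def Rule.Edge (r : Rule B N) (b b' : BoolValuation B N) : Prop :=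
  ∃ f f' : Valuation B N, f.toBool = b ∧ f'.toBool = b' ∧ r.Satisfies f f'

/-- A sketch (a set of rules) is terminating if on each infinite path of its sketch graph some
numerical feature is decreased infinitely often but possibly increased (`n↑` or `n?`) only finitely
often, so that no such path can be followed forever. For finite sketch graphs this is the condition
decided by the Sieve procedure. -/
def Terminating (R : Set (Rule B N)) : Prop :=
  ∀ (b : ℕ → BoolValuation B N) (r : ℕ → Rule B N),
    (∀ i, r i ∈ R ∧ (r i).Edge (b i) (b (i + 1))) →
    ∃ n : N, (∀ i, ∃ j ≥ i, Effect.dec n ∈ (r j).eff) ∧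
      ∃ i, ∀ j ≥ i, Effect.inc n ∉ (r j).eff ∧ Effect.anyNum n ∉ (r j).eff

/-- The features `φ` separate the goals in the class of problems `Q`: there is a single set of
Boolean feature valuations that characterizes the goal states of all problems in the class. -/
def GoalSeparating {ι : Type} (Q : ι → PlanningProblem)
    (φ : (i : ι) → (Q i).State → Valuation B N) : Prop :=
  ∃ V : Set (BoolValuation B N), ∀ (i : ι) (s : (Q i).State),
    s ∈ (Q i).goal ↔ (φ i s).toBool ∈ V

/-- A sketch is well-formed if its features separate the goals and it is terminating. -/
def WellFormed {ι : Type} (Q : ι → PlanningProblem)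
    (φ : (i : ι) → (Q i).State → Valuation B N) (R : Set (Rule B N)) : Prop :=
  GoalSeparating Q φ ∧ Terminating R

/-- The set `G_r(s)` of subgoal states. -/
def subgoals (P : PlanningProblem) (φ : P.State → Valuation B N) (r : Rule B N) (s : P.State) :
    Set P.State :=
  {s' | r.Satisfies (φ s) (φ s')}

/-- The set `S_R(P)` of `R`-reachable states: the initial state, and with each state `s` and each
rule `r` the states in `G_r(s)` that are closest to `s`. -/
inductive Reachable (P : PlanningProblem) (φ : P.State → Valuation B N) (R : Set (Rule B N)) :
    P.State → Prop
  | init : Reachable P φ R P.init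
  | step (s s' : P.State) (r : Rule B N) (π : List P.Act) :
      Reachable P φ R s → r ∈ R →
      P.IsOptimalPlan s (subgoals P φ r s) π → P.Leads s π s' → s' ∈ subgoals P φ r s →
      Reachable P φ R s'

/-- The subproblem `P[s]`: initial state `s`, and as goal states those of `P` and those in `G_r(s)`
for the rules `r` of the sketch. -/
def subproblem (P : PlanningProblem) (φ : P.State → Valuation B N) (R : Set (Rule B N))
    (s : P.State) : PlanningProblem :=
  { P with
    init := s
    goal := P.goal ∪ {s' | ∃ r ∈ R, s' ∈ subgoals P φ r s} }

/-- The width of the sketch `R` over the class `Q` is `k`: the maximum of the widths of all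
subproblems `P[s]` with `P` in `Q` and `s` an `R`-reachable state of `P` is `k`. -/
def HasWidth {ι : Type} (Q : ι → PlanningProblem)
    (φ : (i : ι) → (Q i).State → Valuation B N) (R : Set (Rule B N)) (k : ℕ∞) : Prop :=
  IsGreatest {w : ℕ∞ | ∃ (i : ι) (s : (Q i).State),
    Reachable (Q i) (φ i) R s ∧ w = (subproblem (Q i) (φ i) R s).width} k

end Sketch

/-! ## The Floortile domain -/

namespace Floortile

inductive Color
  | black
  | white

def Color.other : Color → Color
  | .black => .white
  | .white => .black

/-- The data of a Floortile task: a rectangular grid with robots on it, and a rectangular part of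
the grid that has to be painted in chessboard style. Some of the tiles of this part, but no other
tiles, may be painted already. -/
structure Task where
  rows : ℕ
  cols : ℕ
  robots : ℕ
  /-- A tile has to be painted iff its row is in `[rowLo, rowHi)` and its column in
  `[colLo, colHi)`. -/
  rowLo : ℕ
  rowHi : ℕ
  colLo : ℕ
  colHi : ℕ
  /-- The color of the chessboard pattern at the tiles whose coordinates have an even sum. -/
  evenColor : Color
  /-- Initial positions of the robots. -/
  pos : Fin robots → Fin rows × Fin cols
  /-- Initial colors of the brushes. -/
  brush : Fin robots → Color
  /-- Initial colors of the tiles. -/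
  paint : Fin rows × Fin cols → Option Color
  pos_injective : Function.Injective pos
  paint_pos : ∀ a, paint (pos a) = none
  paint_goal : ∀ t, paint t ≠ none →
    (rowLo ≤ t.1.val ∧ t.1.val < rowHi) ∧ (colLo ≤ t.2.val ∧ t.2.val < colHi)

namespace Task

variable (I : Task)

abbrev Tile : Type := Fin I.rows × Fin I.cols

abbrev Robot : Type := Fin I.robots

/-- The tile has to be painted. -/
def IsGoalTile (t : I.Tile) : Prop :=
  (I.rowLo ≤ t.1.val ∧ t.1.val < I.rowHi) ∧ (I.colLo ≤ t.2.val ∧ t.2.val < I.colHi)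

open Classical in
/-- The color that the chessboard pattern prescribes. -/
noncomputable def goalColor (t : I.Tile) : Color :=
  if Even (t.1.val + t.2.val) then I.evenColor else I.evenColor.other

/-- `t'` is directly above `t`. -/
def Up (t t' : I.Tile) : Prop := t'.1.val = t.1.val + 1 ∧ t'.2 = t.2

/-- `t'` is directly below `t`. -/
def Down (t t' : I.Tile) : Prop := t.1.val = t'.1.val + 1 ∧ t'.2 = t.2

/-- `t'` is directly to the right of `t`. -/
def Right (t t' : I.Tile) : Prop := t'.2.val = t.2.val + 1 ∧ t'.1 = t.1

/-- `t'` is directly to the left of `t`. -/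
def Left (t t' : I.Tile) : Prop := t.2.val = t'.2.val + 1 ∧ t'.1 = t.1

/-- Vertically neighboring tiles. -/
def Vertical (t t' : I.Tile) : Prop := I.Up t t' ∨ I.Down t t'

/-- Neighboring tiles. -/
def Adjacent (t t' : I.Tile) : Prop := I.Up t t' ∨ I.Down t t' ∨ I.Right t t' ∨ I.Left t t'

/-- Ground atoms of the predicates that actions can change. -/
inductive Atom
  | robotAt (a : I.Robot) (t : I.Tile)
  | robotHas (a : I.Robot) (c : Color)
  | clear (t : I.Tile)
  | painted (t : I.Tile) (c : Color)

/-- Ground actions: a robot moves to a neighboring tile, paints a tile above or below its own, or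
changes the color of its brush. The static preconditions on the grid are built into the type. -/
inductive Act
  | move (a : I.Robot) (t t' : I.Tile) (h : I.Adjacent t t')
  | paint (a : I.Robot) (t t' : I.Tile) (c : Color) (h : I.Vertical t t')
  | changeColor (a : I.Robot) (c c' : Color)

def pre : I.Act → Set I.Atom
  | .move a t t' _ => {.robotAt a t, .clear t'}
  | .paint a t t' c _ => {.robotHas a c, .robotAt a t, .clear t'}
  | .changeColor a c _ => {.robotHas a c}

def add : I.Act → Set I.Atom
  | .move a t t' _ => {.robotAt a t', .clear t}
  | .paint _ _ t' c _ => {.painted t' c}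
  | .changeColor a _ c' => {.robotHas a c'}

def del : I.Act → Set I.Atom
  | .move a t t' _ => {.robotAt a t, .clear t'}
  | .paint _ _ t' _ _ => {.clear t'}
  | .changeColor a c _ => {.robotHas a c}

/-- The atoms that are true initially. -/
def InitTrue : I.Atom → Prop
  | .robotAt a t => t = I.pos a
  | .robotHas a c => c = I.brush a
  | .clear t => I.paint t = none ∧ ∀ a, I.pos a ≠ t
  | .painted t c => I.paint t = some c

/-- The planning problem of a Floortile task. -/
def problem : PlanningProblem where
  Atom := I.Atom
  Act := I.Act
  pre := I.pre
  add := I.add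
  del := I.del
  init := {p | I.InitTrue p}
  goal := {s | ∀ t, I.IsGoalTile t → Atom.painted t (I.goalColor t) ∈ s}

/-- The tiles that remain to be painted in state `s`. -/
def unpainted (s : Set I.Atom) : Set I.Tile :=
  {t | I.IsGoalTile t ∧ Atom.painted t (I.goalColor t) ∉ s}

/-- From each tile that remains to be painted, a sequence of such tiles leads straight up or
straight down to a tile that does not need to be painted. -/
def VerticalChains (s : Set I.Atom) : Prop :=
  ∀ t ∈ I.unpainted s, ∃ (n : ℕ) (τ : ℕ → I.Tile),
    τ 0 = t ∧ (∀ i < n, τ i ∈ I.unpainted s) ∧ ¬ I.IsGoalTile (τ n) ∧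
    ((∀ i < n, I.Up (τ i) (τ (i + 1))) ∨ (∀ i < n, I.Down (τ i) (τ (i + 1))))

/-- The tiles that do not need to be painted are pairwise connected. -/
def NormalTilesConnected : Prop :=
  ∀ t t' : I.Tile, ¬ I.IsGoalTile t → ¬ I.IsGoalTile t' →
    Relation.ReflTransGen (fun x y => I.Adjacent x y ∧ ¬ I.IsGoalTile y) t t'

end Task

/-- The Boolean feature of the sketch. -/
inductive BoolFeature
  | v

/-- The numerical feature of the sketch. -/
inductive NumFeature
  | g

/-- The Floortile instances: solvable tasks in which the tiles that need no painting are pairwise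
connected. -/
def Instance : Type := {I : Task // I.problem.Solvable ∧ I.NormalTilesConnected}

/-- The planning problems of the Floortile instances. -/
def problems (I : Instance) : PlanningProblem := I.1.problem

/-- The values of the features: `v` states that the vertical chains exist, and `g` counts the tiles
that remain to be painted. -/
noncomputable def features (I : Instance) (s : (problems I).State) :
    Sketch.Valuation BoolFeature NumFeature where
  bool := fun _ => I.1.VerticalChains s
  num := fun _ => (I.1.unpainted s).ncard

/-- The sketch with the single rule `{v, g > 0} ↦ {g↓}`. -/
def sketch : Set (Sketch.Rule BoolFeature NumFeature) :=
  {{ cond := {.pos .v, .gtZero .g}, eff := {.dec .g} }}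

end Floortile

/-! ### Plans and width of general planning problems -/

namespace PlanningProblem

variable {P : PlanningProblem}

/-! Let `U` be the set of unpainted goal tiles of a state; `v` says that `U` is `Open`: each of its
tiles has a vertical exit through `U` to a normal tile. Openness propagates backwards along plans
(`Run.open_of_open`). Indeed, a robot that paints `τ` stands directly above or below it on an
unpainted tile; the exit of that tile cannot lead back through the painted `τ`, so prolonging it by
one step gives an exit of `τ`. Goal states have `U = ∅`, which is open, so every solvable instance
starts open. The rule preserves `v`, hence it applies until `g = 0`.

By the same backward argument, an optimal plan for the subgoal stops as soon as some `τ` gets its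
prescribed color. Conversely, optimal plans for that color of `τ` paint nothing else, because
painted tiles never enable an action. So the subproblem has an optimal plan for a single atom
`painted τ c`, all of whose optimal plans solve the subproblem optimally
(`exists_tile_of_isOptimalPlan`). A plan exists at all: some tile can be removed from `U` without
destroying openness, robots are at most as many as normal tiles, so some unpainted tile is clear,
and the unpainted part of the grid is connected, so the clear tile can be shifted to the chosen one
and a robot brought next to it (`Proper.exists_isPlan_subgoal`).

For width at most 2, `exists_ladder` builds a chain of atom pairs ending in `painted τ c`. If `τ` is
clear, a nearest robot walks to it, changes color if necessary, and paints. If a robot is on `τ`,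
the distance from `τ` to the nearest clear tile is what counts: the robots on a shortest path make
way one after the other. Two atoms suffice because of counting: a plan as short as the lower bound
has no spare action, so whatever the pair does not mention has not changed in a harmful way.

Width at least 2 is witnessed by `twoTiles`: a robot must leave the tile and change color before
painting, and each atom true just before the painting can be reached alone in at most one action. -/

theorem leads_append {s s' : P.State} {π π' : List P.Act} :
    P.Leads s (π ++ π') s' ↔ ∃ u, P.Leads s π u ∧ P.Leads u π' s' := by
  induction π generalizing s with
  | nil => simp [Leads]
  | cons a π ih => simp [Leads, ih, and_assoc]

theorem leads_concat {s s' : P.State} {π : List P.Act} {a : P.Act} :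
    P.Leads s (π ++ [a]) s' ↔ ∃ u, P.Leads s π u ∧ P.pre a ⊆ u ∧ s' = P.result a u := by
  simp [leads_append, Leads]

theorem IsPlan.exists_isOptimalPlan {s : P.State} {G : Set P.State} {π : List P.Act}
    (h : P.IsPlan s G π) : ∃ π', P.IsOptimalPlan s G π' := by
  classical
  have hex : ∃ n, ∃ π', P.IsPlan s G π' ∧ π'.length = n := ⟨_, π, h, rfl⟩
  obtain ⟨π', hπ', hn⟩ := Nat.find_spec hex
  exact ⟨π', hπ', fun σ hσ => hn ▸ Nat.find_min' hex ⟨σ, hσ, rfl⟩⟩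

theorem IsOptimalPlan.length_eq {s : P.State} {G : Set P.State} {π π' : List P.Act}
    (h : P.IsOptimalPlan s G π) (h' : P.IsOptimalPlan s G π') : π.length = π'.length :=
  le_antisymm (h.2 _ h'.1) (h'.2 _ h.1)

/-- In an admissible chain, the `i`-th tuple has an optimal plan of length `i`. -/
theorem IsAdmissibleChain.exists_isOptimalPlanFor {m : ℕ} {t : ℕ → Finset P.Atom}
    (h : P.IsAdmissibleChain m t) :
    ∀ i ≤ m, ∃ π, P.IsOptimalPlanFor (t i) π ∧ π.length = i := by
  intro i
  induction i with
  | zero => exact fun _ => ⟨[], ⟨⟨P.init, h.1, rfl⟩, fun _ _ => Nat.zero_le _⟩, rfl⟩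
  | succ i ih =>
    intro hi
    obtain ⟨π, hπ, hlen⟩ := ih (Nat.le_of_succ_le hi)
    obtain ⟨a, ha⟩ := h.2.1 i hi π hπ
    exact ⟨π ++ [a], ha, by simp [hlen]⟩

theorem width_eq_zero {π : List P.Act} (h : P.IsPlan P.init P.goal π) (hπ : π.length ≤ 1) :
    P.width = 0 := by
  have hs : P.Solvable := ⟨π, h⟩
  rw [width, if_neg (not_not.mpr hs), if_pos ⟨π, h, hπ⟩]

/-- An admissible chain itself provides a plan, so the unsolvable case is void. Plans of length at
most one need a separate case, since they make the width 0 by definition. -/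
theorem IsAdmissibleChain.width_le {m k : ℕ} {t : ℕ → Finset P.Atom}
    (h : P.IsAdmissibleChain m t) (hk : ∀ i ≤ m, (t i).card ≤ k) : P.width ≤ k := by
  obtain ⟨π, hπ, -⟩ := h.exists_isOptimalPlanFor m le_rfl
  have hs : P.Solvable := ⟨π, (h.2.2 π hπ).1⟩
  by_cases h1 : ∃ π, P.IsPlan P.init P.goal π ∧ π.length ≤ 1
  · obtain ⟨σ, hσ, hlen⟩ := h1
    exact (width_eq_zero hσ hlen).le.trans zero_le
  · rw [width, if_neg (not_not.mpr hs), if_neg h1]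
    exact sInf_le ⟨k, rfl, m, t, h, hk⟩

end PlanningProblem

namespace Sketch

variable {B N : Type} {P : PlanningProblem} {φ : P.State → Valuation B N}
  {R : Set (Rule B N)} {s₀ : P.State}

/-- A subproblem differs from the problem only in its initial and goal states, so plans between
given states are the same. -/
theorem leads_subproblem {s s' : P.State} {π : List P.Act} :
    (subproblem P φ R s₀).Leads s π s' ↔ P.Leads s π s' := by
  induction π generalizing s with
  | nil => exact Iff.rfl
  | cons a π ih => exact and_congr Iff.rfl (ih (s := P.result a s))

theorem isPlan_subproblem {s : P.State} {G : Set P.State} {π : List P.Act} :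
    (subproblem P φ R s₀).IsPlan s G π ↔ P.IsPlan s G π :=
  exists_congr fun _ => and_congr Iff.rfl leads_subproblem

theorem isOptimalPlan_subproblem {s : P.State} {G : Set P.State} {π : List P.Act} :
    (subproblem P φ R s₀).IsOptimalPlan s G π ↔ P.IsOptimalPlan s G π :=
  and_congr isPlan_subproblem (forall_congr' fun _ => imp_congr isPlan_subproblem Iff.rfl)

end Sketch

/-! ### Configurations and their correspondence with states -/

namespace Floortile.Task

variable {I : Task}

section Grid

variable {t t' : I.Tile}

theorem Adjacent.ne (h : I.Adjacent t t') : t ≠ t' := by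
  rintro rfl
  rcases h with h | h | h | h <;> exact absurd h.1 (by omega)

theorem Adjacent.symm (h : I.Adjacent t t') : I.Adjacent t' t := by
  rcases h with h | h | h | h
  · exact .inr (.inl ⟨h.1, h.2.symm⟩)
  · exact .inl ⟨h.1, h.2.symm⟩
  · exact .inr (.inr (.inr ⟨h.1, h.2.symm⟩))
  · exact .inr (.inr (.inl ⟨h.1, h.2.symm⟩))

theorem Vertical.adjacent (h : I.Vertical t t') : I.Adjacent t t' :=
  h.elim .inl fun h => .inr (.inl h)

end Grid

/-- A configuration: every robot is at one tile and has one color, and a tile has at most one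
color. -/
structure Config (I : Task) where
  pos : I.Robot → I.Tile
  brush : I.Robot → Color
  paint : I.Tile → Option Color
  pos_injective : Function.Injective pos
  paint_pos : ∀ a, paint (pos a) = none

namespace Config

/-- The tile is not painted and no robot is on it. -/
def Free (C : Config I) (t : I.Tile) : Prop := C.paint t = none ∧ ∀ a, C.pos a ≠ t

/-- The atoms that are true in a configuration. -/
def Holds (C : Config I) : I.Atom → Prop
  | .robotAt a t => C.pos a = t
  | .robotHas a c => C.brush a = c
  | .clear t => C.Free t
  | .painted t c => C.paint t = some c

/-- The state of the planning problem that corresponds to a configuration. -/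
def state (C : Config I) : Set I.Atom := {p | C.Holds p}

/-- The action leads from the first to the second configuration. -/
def Step (C : Config I) : I.Act → Config I → Prop
  | .move a t t' _, D => C.pos a = t ∧ C.Free t' ∧ D.pos = Function.update C.pos a t' ∧
      D.brush = C.brush ∧ D.paint = C.paint
  | .paint a t t' c _, D => C.pos a = t ∧ C.brush a = c ∧ C.Free t' ∧ D.pos = C.pos ∧
      D.brush = C.brush ∧ D.paint = Function.update C.paint t' (some c)
  | .changeColor a c c', D => C.brush a = c ∧ D.pos = C.pos ∧
      D.brush = Function.update C.brush a c' ∧ D.paint = C.paint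

theorem exists_step_move (C : Config I) {a : I.Robot} {t t' : I.Tile} (h : I.Adjacent t t')
    (ht : C.pos a = t) (ht' : C.Free t') : ∃ D, Step C (.move a t t' h) D := by
  refine ⟨⟨Function.update C.pos a t', C.brush, C.paint, ?_, ?_⟩, ht, ht', rfl, rfl, rfl⟩
  · intro x y hxy
    by_cases hx : x = a <;> by_cases hy : y = a
    · rw [hx, hy]
    · subst hx
      simp only [Function.update_self, Function.update_of_ne hy] at hxy
      exact absurd hxy.symm (ht'.2 y)
    · subst hy
      simp only [Function.update_self, Function.update_of_ne hx] at hxy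
      exact absurd hxy (ht'.2 x)
    · simp only [Function.update_of_ne hx, Function.update_of_ne hy] at hxy
      exact C.pos_injective hxy
  · intro x
    by_cases hx : x = a
    · subst hx; simpa using ht'.1
    · simpa [Function.update_of_ne hx] using C.paint_pos x

theorem exists_step_paint (C : Config I) {a : I.Robot} {t t' : I.Tile} {c : Color}
    (h : I.Vertical t t') (ht : C.pos a = t) (hc : C.brush a = c) (ht' : C.Free t') :
    ∃ D, Step C (.paint a t t' c h) D := by
  refine ⟨⟨C.pos, C.brush, Function.update C.paint t' (some c), C.pos_injective, ?_⟩, ht, hc, ht',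
    rfl, rfl, rfl⟩
  intro x
  rw [Function.update_of_ne (ht'.2 x)]
  exact C.paint_pos x

theorem exists_step_changeColor (C : Config I) {a : I.Robot} {c : Color} (c' : Color)
    (hc : C.brush a = c) : ∃ D, Step C (.changeColor a c c') D :=
  ⟨⟨C.pos, Function.update C.brush a c', C.paint, C.pos_injective, C.paint_pos⟩, hc, rfl, rfl, rfl⟩

theorem exists_step {C : Config I} {a : I.Act} (h : I.pre a ⊆ C.state) : ∃ D, Step C a D := by
  cases a with
  | move a t t' hadj =>
    exact exists_step_move C hadj (h (.inl rfl)) (h (.inr rfl))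
  | paint a t t' c hv =>
    exact exists_step_paint C hv (h (.inr (.inl rfl))) (h (.inl rfl)) (h (.inr (.inr rfl)))
  | changeColor a c c' => exact exists_step_changeColor C c' (h rfl)

theorem Step.pre_subset {C D : Config I} {a : I.Act} (h : Step C a D) : I.pre a ⊆ C.state := by
  cases a with
  | move a t t' hadj =>
    rintro p (rfl | rfl)
    exacts [h.1, h.2.1]
  | paint a t t' c hv =>
    rintro p (rfl | rfl | rfl)
    exacts [h.2.1, h.1, h.2.2.1]
  | changeColor a c c' =>
    rintro p rfl
    exact h.1

/-- Consistency makes the add and delete lists agree with function updates: injectivity of positions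
makes a vacated tile clear, and a clear tile has no color to be overwritten. -/
theorem Step.result_eq {C D : Config I} {a : I.Act} (h : Step C a D) :
    I.problem.result a C.state = D.state := by
  suffices H : ∀ p : I.Atom, (C.Holds p ∧ p ∉ I.del a) ∨ p ∈ I.add a ↔ D.Holds p from Set.ext H
  cases a with
  | move a t t' hadj =>
    obtain ⟨rfl, ht', hp, hb, hm⟩ := h
    have hne := hadj.ne
    intro p
    simp only [add, del, Set.mem_insert_iff, Set.mem_singleton_iff]
    cases p with
    | robotAt b t =>
      simp only [Holds, hp, Atom.robotAt.injEq, reduceCtorEq, or_false]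
      by_cases hba : b = a
      · subst hba
        simp only [Function.update_self]
        grind
      · simp [hba]
    | robotHas b c => simp [Holds, hb]
    | clear t =>
      simp only [Holds, Free, hp, hm, Atom.clear.injEq, reduceCtorEq, false_or]
      constructor
      · rintro (⟨⟨h1, h2⟩, h3⟩ | rfl)
        · refine ⟨h1, fun b => ?_⟩
          by_cases hba : b = a
          · subst hba; simpa using Ne.symm h3
          · simpa [Function.update_of_ne hba] using h2 b
        · refine ⟨C.paint_pos a, fun b => ?_⟩
          by_cases hba : b = a
          · subst hba; simpa using hne.symm
          · simpa [Function.update_of_ne hba] using fun h => hba (C.pos_injective h)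
      · rintro ⟨h1, h2⟩
        by_cases hta : t = C.pos a
        · exact .inr hta
        · refine .inl ⟨⟨h1, fun b hb' => ?_⟩, fun htt => ?_⟩
          · by_cases hba : b = a
            · subst hba; exact hta hb'.symm
            · exact h2 b (by rwa [Function.update_of_ne hba])
          · exact h2 a (by rw [Function.update_self, htt])
    | painted t c => simp [Holds, hm]
  | paint a t t' c hv =>
    obtain ⟨rfl, rfl, ht', hp, hb, hm⟩ := h
    intro p
    simp only [add, del, Set.mem_singleton_iff]
    cases p with
    | robotAt b t => simp [Holds, hp]
    | robotHas b c => simp [Holds, hb]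
    | clear t =>
      simp only [Holds, Free, hp, hm, Atom.clear.injEq, reduceCtorEq, or_false]
      by_cases htt : t = t'
      · subst htt; simp
      · simp [htt]
    | painted t c =>
      simp only [Holds, hm, Atom.painted.injEq, reduceCtorEq, not_false_eq_true, and_true]
      by_cases htt : t = t'
      · subst htt
        simp only [true_and, Function.update_self, Option.some.injEq, ht'.1, reduceCtorEq, false_or]
        exact eq_comm
      · simp [htt]
  | changeColor a c c' =>
    obtain ⟨rfl, hp, hb, hm⟩ := h
    intro p
    simp only [add, del, Set.mem_singleton_iff]
    cases p with
    | robotAt b t => simp [Holds, hp]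
    | robotHas b c =>
      simp only [Holds, hb, Atom.robotHas.injEq]
      by_cases hba : b = a
      · subst hba
        simp only [Function.update_self]
        grind
      · simp [hba]
    | clear t => simp [Holds, Free, hp, hm]
    | painted t c => simp [Holds, hm]

/-- The action sequence leads from the first to the second configuration. -/
inductive Run (C : Config I) : List I.Act → Config I → Prop
  | nil : Run C [] C
  | snoc {π D a D'} : Run C π D → Step D a D' → Run C (π ++ [a]) D'

/-- All states reachable from a configuration are configurations, so statements about plans become
statements about robots and tiles. -/
theorem leads_state_iff {C : Config I} {π : List I.Act} {s : Set I.Atom} :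
    I.problem.Leads C.state π s ↔ ∃ D : Config I, s = D.state ∧ Run C π D := by
  constructor
  · induction π using List.reverseRecOn generalizing s with
    | nil => exact fun h => ⟨C, h, .nil⟩
    | append_singleton π a ih =>
      intro h
      obtain ⟨u, hu, hpre, rfl⟩ := PlanningProblem.leads_concat.mp h
      obtain ⟨D, rfl, hD⟩ := ih hu
      obtain ⟨D', hD'⟩ := exists_step hpre
      exact ⟨D', hD'.result_eq, hD.snoc hD'⟩
  · rintro ⟨D, rfl, hD⟩
    induction hD with
    | nil => rfl
    | snoc _ hs ih =>
      exact PlanningProblem.leads_concat.mpr ⟨_, ih, hs.pre_subset, hs.result_eq.symm⟩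

theorem Run.trans {C D E : Config I} {π π' : List I.Act} (h : Run C π D) (h' : Run D π' E) :
    Run C (π ++ π') E := by
  induction h' with
  | nil => simpa using h
  | snoc _ hs ih => rw [← List.append_assoc]; exact ih.snoc hs

/-! ### Counting moves and color changes in plans -/

/-- The number of moves that an action makes: `0` or `1`. -/
def moves : I.Act → ℕ
  | .move .. => 1
  | _ => 0

/-- The number of moves that an action makes with the robot `b`: `0` or `1`. -/
def movesBy (b : I.Robot) : I.Act → ℕ
  | .move a .. => if a = b then 1 else 0
  | _ => 0

/-- The number of color changes that an action makes with the robot `b`: `0` or `1`. -/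
def changesBy (b : I.Robot) : I.Act → ℕ
  | .changeColor a .. => if a = b then 1 else 0
  | _ => 0

/-- The total number of occurrences in an action sequence. -/
def total (f : I.Act → ℕ) (π : List I.Act) : ℕ := (π.map f).sum

theorem total_concat (f : I.Act → ℕ) (π : List I.Act) (a : I.Act) :
    total f (π ++ [a]) = total f π + f a := by simp [total]

theorem total_le_length {f : I.Act → ℕ} (hf : ∀ a, f a ≤ 1) (π : List I.Act) :
    total f π ≤ π.length := by
  induction π using List.reverseRecOn with
  | nil => simp [total]
  | append_singleton π a ih =>
    rw [total_concat, List.length_append, List.length_singleton]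
    exact add_le_add ih (hf a)

/-- This turns tightness of a length bound into knowledge of the plan: if the count exhausts the
length, no action is left for anything uncounted. -/
theorem eq_one_of_length_le_total {f : I.Act → ℕ} (hf : ∀ a, f a ≤ 1) {π : List I.Act}
    (h : π.length ≤ total f π) : ∀ a ∈ π, f a = 1 := by
  induction π using List.reverseRecOn with
  | nil => simp
  | append_singleton π a ih =>
    rw [total_concat, List.length_append, List.length_singleton] at h
    have h1 := hf a
    have h2 := total_le_length hf π
    intro x hx
    rcases List.mem_append.mp hx with hx | hx
    · exact ih (by omega) x hx
    · rw [List.mem_singleton.mp hx]; omega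

theorem moves_le_one (a : I.Act) : moves a ≤ 1 := by cases a <;> simp [moves]

theorem movesBy_le_one (b : I.Robot) (a : I.Act) : movesBy b a ≤ 1 := by
  cases a <;> simp only [movesBy] <;> (try split_ifs) <;> simp

theorem movesBy_add_changesBy_le_one (b : I.Robot) (a : I.Act) :
    movesBy b a + changesBy b a ≤ 1 := by
  cases a <;> simp only [movesBy, changesBy] <;> (try split_ifs) <;> simp

theorem moves_add_changesBy_le_one (b : I.Robot) (a : I.Act) : moves a + changesBy b a ≤ 1 := by
  cases a <;> simp only [moves, changesBy] <;> (try split_ifs) <;> simp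

theorem total_add (f f' : I.Act → ℕ) (π : List I.Act) :
    total (fun a => f a + f' a) π = total f π + total f' π := by
  simp [total, List.sum_map_add]

variable {C D : Config I} {π : List I.Act}

/-- Only clear tiles are painted, so colors are permanent. -/
theorem Step.paint_of_eq_some {C D : Config I} {a : I.Act} (h : Step C a D) {t : I.Tile}
    {c : Color} (ht : C.paint t = some c) : D.paint t = some c := by
  cases a with
  | move => rw [h.2.2.2.2, ht]
  | changeColor => rw [h.2.2.2, ht]
  | paint a x t' c' hv =>
    rw [h.2.2.2.2.2, Function.update_of_ne, ht]
    rintro rfl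
    exact absurd (h.2.2.1.1.symm.trans ht) (by simp)

theorem Run.paint_of_eq_some (h : Run C π D) {t : I.Tile} {c : Color}
    (ht : C.paint t = some c) : D.paint t = some c := by
  induction h with
  | nil => exact ht
  | snoc _ hs ih => exact hs.paint_of_eq_some ih

theorem Run.paint_eq_none (h : Run C π D) {t : I.Tile} (ht : D.paint t = none) :
    C.paint t = none := by
  by_contra hne
  obtain ⟨c, hc⟩ := Option.ne_none_iff_exists'.mp hne
  rw [h.paint_of_eq_some hc] at ht
  exact absurd ht (by simp)

theorem Run.pos_eq (h : Run C π D) {b : I.Robot} (hb : ∀ a ∈ π, movesBy b a = 0) :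
    D.pos b = C.pos b := by
  induction h with
  | nil => rfl
  | @snoc π D a D' _ hs ih =>
    rw [← ih fun x hx => hb x (by simp [hx])]
    have := hb a (by simp)
    cases a with
    | move r t t' hadj =>
      rw [hs.2.2.1, Function.update_of_ne]
      rintro rfl
      simp [movesBy] at this
    | paint => rw [hs.2.2.2.1]
    | changeColor => rw [hs.2.1]

theorem Run.brush_eq (h : Run C π D) {b : I.Robot} (hb : ∀ a ∈ π, changesBy b a = 0) :
    D.brush b = C.brush b := by
  induction h with
  | nil => rfl
  | @snoc π D a D' _ hs ih =>
    rw [← ih fun x hx => hb x (by simp [hx])]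
    have := hb a (by simp)
    cases a with
    | move => rw [hs.2.2.2.1]
    | paint => rw [hs.2.2.2.2.1]
    | changeColor r c c' =>
      rw [hs.2.2.1, Function.update_of_ne]
      rintro rfl
      simp [changesBy] at this

theorem Run.paint_eq (h : Run C π D) {t : I.Tile}
    (hp : ∀ r x c hv, Act.paint r x t c hv ∉ π) : D.paint t = C.paint t := by
  induction h with
  | nil => rfl
  | @snoc π D a D' _ hs ih =>
    rw [← ih fun r x c hv hm => hp r x c hv (by simp [hm])]
    cases a with
    | move => rw [hs.2.2.2.2]
    | changeColor => rw [hs.2.2.2]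
    | paint r x t' c hv =>
      rw [hs.2.2.2.2.2, Function.update_of_ne]
      rintro rfl
      exact hp r x c hv (by simp)

theorem total_eq_zero {f : I.Act → ℕ} (h : total f π = 0) : ∀ a ∈ π, f a = 0 := by
  simpa [total, List.sum_eq_zero_iff] using h

theorem Run.one_le_changesBy (h : Run C π D) {b : I.Robot} (hb : D.brush b ≠ C.brush b) :
    1 ≤ total (changesBy b) π := by
  by_contra hlt
  exact hb (h.brush_eq (total_eq_zero (by omega)))

theorem Run.one_le_movesBy (h : Run C π D) {b : I.Robot} (hb : D.pos b ≠ C.pos b) :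
    1 ≤ total (movesBy b) π := by
  by_contra hlt
  exact hb (h.pos_eq (total_eq_zero (by omega)))

/-- If the robot `b` does everything, by moves and color changes, then nothing else changes. -/
theorem Run.of_all_by (h : Run C π D) {b : I.Robot}
    (hl : π.length ≤ total (movesBy b) π + total (changesBy b) π) :
    (∀ r ≠ b, D.pos r = C.pos r) ∧ D.paint = C.paint := by
  rw [← total_add] at hl
  have hall := eq_one_of_length_le_total (movesBy_add_changesBy_le_one b) hl
  refine ⟨fun r hr => h.pos_eq fun a ha => ?_, funext fun t => h.paint_eq fun r x c hv hm => ?_⟩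
  · have := hall a ha
    cases a with
    | move r' => simp only [movesBy, changesBy] at this ⊢; grind
    | paint => rfl
    | changeColor => rfl
  · simpa [movesBy, changesBy] using hall _ hm

/-- If there are only moves and color changes of the robot `b`, then nothing is painted and no other
brush changes. -/
theorem Run.of_all_moves (h : Run C π D) {b : I.Robot}
    (hl : π.length ≤ total moves π + total (changesBy b) π) :
    D.paint = C.paint ∧ ∀ r ≠ b, D.brush r = C.brush r := by
  rw [← total_add] at hl
  have hall := eq_one_of_length_le_total (moves_add_changesBy_le_one b) hl
  refine ⟨funext fun t => h.paint_eq fun r x c hv hm => ?_, fun r hr => h.brush_eq fun a ha => ?_⟩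
  · simpa [moves, changesBy] using hall _ hm
  · have := hall a ha
    cases a with
    | changeColor r' => simp only [moves, changesBy] at this ⊢; grind
    | paint => rfl
    | move => rfl

theorem Run.of_moves (h : Run C π D) (hl : π.length ≤ total moves π) :
    D.paint = C.paint ∧ D.brush = C.brush := by
  have hall := eq_one_of_length_le_total moves_le_one hl
  refine ⟨funext fun t => h.paint_eq fun r x c hv hm => ?_,
    funext fun r => h.brush_eq fun a ha => ?_⟩
  · simpa [moves] using hall _ hm
  · have := hall a ha
    cases a with
    | changeColor => simp [moves] at this
    | paint => rfl
    | move => rfl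

end Config

end Floortile.Task

/-! ### Ladders, distances, and painting a tile without a robot -/

namespace Floortile.Task.Config

variable {I : Task} {C D : Config I} {π : List I.Act}

/-- A sequence of atom pairs, starting with a pair that is true in `C`, such that the `i`-th pair
cannot be reached with fewer than `i` actions and every plan of length `i` for it can be extended by
a single action to a plan for the next pair. `Ladder C n p q` states that there is such a sequence
that ends with `p`, `q` at index `n`. -/
inductive Ladder (C : Config I) : ℕ → I.Atom → I.Atom → Prop
  | zero {p q} : p ∈ C.state → q ∈ C.state → Ladder C 0 p q
  | succ {n p q p' q'} : Ladder C n p q →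
      (∀ π D, Run C π D → p' ∈ D.state → q' ∈ D.state → n + 1 ≤ π.length) →
      (∀ π D, Run C π D → π.length = n → p ∈ D.state → q ∈ D.state →
        ∃ a D', Step D a D' ∧ p' ∈ D'.state ∧ q' ∈ D'.state) → Ladder C (n + 1) p' q'

/-- The tiles that have distance at most `n` from `S`, on the part of the grid that is not painted
in the configuration `C`. -/
def Level (C : Config I) (S : Set I.Tile) : ℕ → Set I.Tile
  | 0 => S
  | n + 1 => {x | x ∈ Level C S n ∨ C.paint x = none ∧ ∃ y ∈ Level C S n, I.Adjacent x y}

variable {S : Set I.Tile}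

theorem level_mono {m n : ℕ} (h : m ≤ n) : Level C S m ⊆ Level C S n :=
  monotone_nat_of_le_succ (f := Level C S) (fun _ _ hx => .inl hx) h

theorem paint_eq_none_of_mem_level (hS : ∀ x ∈ S, C.paint x = none) {n : ℕ} {x : I.Tile}
    (hx : x ∈ Level C S n) : C.paint x = none := by
  induction n with
  | zero => exact hS x hx
  | succ n ih => exact hx.elim ih fun h => h.1

/-- The tile has distance `n` from `S`. -/
def AtLevel (C : Config I) (S : Set I.Tile) (n : ℕ) (x : I.Tile) : Prop :=
  x ∈ Level C S n ∧ ∀ k < n, x ∉ Level C S k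

theorem exists_atLevel {n : ℕ} {x : I.Tile} (hx : x ∈ Level C S n) :
    ∃ k ≤ n, AtLevel C S k x := by
  classical
  have hex : ∃ k, x ∈ Level C S k := ⟨n, hx⟩
  exact ⟨Nat.find hex, Nat.find_min' hex hx, Nat.find_spec hex, fun k hk => Nat.find_min hex hk⟩

theorem AtLevel.exists_adjacent {n : ℕ} {x : I.Tile} (hx : AtLevel C S (n + 1) x) :
    ∃ y, I.Adjacent x y ∧ AtLevel C S n y := by
  obtain ⟨hpaint, y, hy, hadj⟩ := hx.1.resolve_left (hx.2 n n.lt_succ_self)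
  exact ⟨y, hadj, hy, fun k hk hyk => hx.2 (k + 1) (by omega) (.inr ⟨hpaint, y, hyk, hadj⟩)⟩

/-- The walk of the robot is traced backwards, one level per move. Colors are permanent, so every
tile it visits was already unpainted in `C`, where distances are measured. -/
theorem Run.pos_mem_level (h : Run C π D) {r : I.Robot} {k : ℕ} (hk : D.pos r ∈ Level C S k) :
    C.pos r ∈ Level C S (k + total (movesBy r) π) := by
  induction h generalizing k with
  | nil => exact hk
  | @snoc π D a D' h hs ih =>
    rw [total_concat]
    cases a with
    | paint => exact ih (hs.2.2.2.1 ▸ hk)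
    | changeColor => exact ih (hs.2.1 ▸ hk)
    | move b t t' hadj =>
      obtain ⟨rfl, -, hp, -, -⟩ := hs
      rw [hp] at hk
      by_cases hb : r = b
      · subst hb
        rw [Function.update_self] at hk
        have := ih (k := k + 1) (.inr ⟨h.paint_eq_none (D.paint_pos r), t', hk, hadj⟩)
        simpa [movesBy, add_assoc, add_comm, add_left_comm] using this
      · rw [Function.update_of_ne hb] at hk
        exact level_mono (by omega) (ih hk)

theorem total_movesBy_le (b : I.Robot) (π : List I.Act) : total (movesBy b) π ≤ π.length :=
  total_le_length (movesBy_le_one b) π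

theorem Step.vertical_of_paint {a : I.Act} (hs : Step C a D) {τ : I.Tile} {c : Color}
    (hC : C.paint τ ≠ some c) (hD : D.paint τ = some c) :
    ∃ r, I.Vertical (C.pos r) τ ∧ C.brush r = c ∧ C.Free τ := by
  cases a with
  | move => exact absurd (hs.2.2.2.2 ▸ hD) hC
  | changeColor => exact absurd (hs.2.2.2 ▸ hD) hC
  | paint b t t' c' hv =>
    obtain ⟨rfl, rfl, hfree, -, -, hm⟩ := hs
    rw [hm] at hD
    by_cases htt : τ = t'
    · subst htt
      rw [Function.update_self] at hD
      exact ⟨b, hv, Option.some.inj hD, hfree⟩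
    · rw [Function.update_of_ne htt] at hD
      exact absurd hD hC

/-- A plan that paints `τ` ends, up to further actions, with a robot that stands above or below the
clear tile `τ`. -/
theorem Run.exists_before_paint (h : Run C π D) {τ : I.Tile} {c : Color}
    (hτ : C.paint τ = none) (hD : D.paint τ = some c) :
    ∃ π' E r, Run C π' E ∧ π'.length + 1 ≤ π.length ∧ I.Vertical (E.pos r) τ ∧ E.brush r = c ∧
      E.Free τ := by
  induction h with
  | nil => simp [hτ] at hD
  | @snoc π D a D' h hs ih =>
    by_cases hc : D.paint τ = some c
    · obtain ⟨π', E, r, h1, h2, h3⟩ := ih hc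
      exact ⟨π', E, r, h1, by simp; omega, h3⟩
    · obtain ⟨r, hr⟩ := hs.vertical_of_paint hc hD
      exact ⟨π, D, r, h, by simp, hr⟩

theorem exists_step_painted {b : I.Robot} {τ : I.Tile} {c : Color}
    (hv : I.Vertical (D.pos b) τ) (hc : D.brush b = c) (hf : D.Free τ) :
    ∃ a D', Step D a D' ∧ Atom.painted τ c ∈ D'.state ∧ Atom.painted τ c ∈ D'.state := by
  obtain ⟨D', hD'⟩ := exists_step_paint D hv rfl hc hf
  have : Atom.painted τ c ∈ D'.state := by
    change D'.paint τ = some c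
    rw [hD'.2.2.2.2.2, Function.update_self]
  exact ⟨_, D', hD', this, this⟩

theorem exists_step_robotHas {b : I.Robot} (c : Color) {t : I.Tile} (ht : D.pos b = t) :
    ∃ a D', Step D a D' ∧ Atom.robotAt b t ∈ D'.state ∧ Atom.robotHas b c ∈ D'.state := by
  obtain ⟨D', hD'⟩ := exists_step_changeColor D c (a := b) rfl
  refine ⟨_, D', hD', ?_, ?_⟩
  · change D'.pos b = t
    rw [hD'.2.1, ht]
  · change D'.brush b = c
    rw [hD'.2.2.1, Function.update_self]

/-- A nearest robot can walk to `S`. -/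
theorem ladder_walk (hS : ∀ x ∈ S, C.paint x = none) {N : ℕ} {b : I.Robot}
    (hN : ∀ r, ∀ k < N, C.pos r ∉ Level C S k) (hb : C.pos b ∈ Level C S N) :
    ∀ i ≤ N, ∃ x, AtLevel C S (N - i) x ∧ Ladder C i (.robotAt b x) (.robotAt b x) := by
  intro i
  induction i with
  | zero => exact fun _ => ⟨C.pos b, ⟨hb, hN b⟩, .zero rfl rfl⟩
  | succ i ih =>
    intro hi
    obtain ⟨x, hx, hlad⟩ := ih (by omega)
    obtain ⟨k, hk⟩ : ∃ k, N - i = k + 1 := ⟨N - i - 1, by omega⟩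
    rw [hk] at hx
    obtain ⟨y, hadj, hy⟩ := hx.exists_adjacent
    refine ⟨y, (by rwa [show N - (i + 1) = k by omega]), hlad.succ ?_ ?_⟩
    · intro π D h hD _
      change D.pos b = y at hD
      have h1 := h.pos_mem_level (r := b) (hD ▸ hy.1)
      have h2 : N ≤ k + total (movesBy b) π := not_lt.mp fun hlt => hN b _ hlt h1
      have h3 := total_movesBy_le b π
      omega
    · intro π D h hlen hD _
      change D.pos b = x at hD
      have h1 := h.pos_mem_level (r := b) (hD ▸ hx.1)
      -- Here `N - (k + 1) = i`, so a plan of length `i` consists of moves of `b` alone. The other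
      -- robots are still where they started, at distance at least `N`, hence not on `y`.
      have h2 : N ≤ k + 1 + total (movesBy b) π := not_lt.mp fun hlt => hN b _ hlt h1
      obtain ⟨hpos, hpaint⟩ := h.of_all_by (b := b) (by omega)
      have hfree : D.Free y := by
        refine ⟨by rw [hpaint]; exact paint_eq_none_of_mem_level hS hy.1, fun r => ?_⟩
        by_cases hr : r = b
        · rw [hr, hD]; exact hadj.ne
        · rw [hpos r hr]
          rintro rfl
          exact hN r k (by omega) hy.1
      obtain ⟨D', hD'⟩ := exists_step_move D hadj hD hfree
      have : Atom.robotAt b y ∈ D'.state := by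
        change D'.pos b = y
        rw [hD'.2.2.1, Function.update_self]
      exact ⟨_, D', hD', this, this⟩

/-- A tile without a robot is painted by a nearest robot. -/
theorem exists_ladder_of_free {τ : I.Tile} {c : Color} (hτ : C.Free τ)
    (hrun : ∃ π D, Run C π D ∧ D.paint τ = some c) :
    ∃ n, Ladder C n (.painted τ c) (.painted τ c) := by
  classical
  let S : Set I.Tile := {t | I.Vertical t τ ∧ C.paint t = none}
  have hS : ∀ x ∈ S, C.paint x = none := fun x hx => hx.2
  have hbefore : ∀ π D, Run C π D → D.paint τ = some c → ∃ π' E r, Run C π' E ∧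
      π'.length + 1 ≤ π.length ∧ E.brush r = c ∧ C.pos r ∈ Level C S (total (movesBy r) π') := by
    intro π D h hD
    obtain ⟨π', E, r, h1, h2, h3, h4, -⟩ := h.exists_before_paint hτ.1 hD
    refine ⟨π', E, r, h1, h2, h4, ?_⟩
    have := h1.pos_mem_level (S := S) (r := r) (k := 0) ⟨h3, h1.paint_eq_none (E.paint_pos r)⟩
    simpa using this
  have hex : ∃ n, ∃ r, C.pos r ∈ Level C S n := by
    obtain ⟨π, D, h, hD⟩ := hrun
    obtain ⟨π', E, r, -, -, -, h4⟩ := hbefore π D h hD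
    exact ⟨_, r, h4⟩
  obtain ⟨N, ⟨b₀, hb₀⟩, hmin⟩ : ∃ N, (∃ r, C.pos r ∈ Level C S N) ∧
      ∀ r, ∀ k < N, C.pos r ∉ Level C S k :=
    ⟨Nat.find hex, Nat.find_spec hex, fun r k hk hr => Nat.find_min hex hk ⟨r, hr⟩⟩
  -- At least `N` moves of the painter precede the painting. If there are no other actions, there is
  -- no room for a color change, so the painter is a nearest robot that had the right color from the
  -- start.
  have hlow : ∀ π D, Run C π D → D.paint τ = some c → N + 1 ≤ π.length ∧
      (π.length = N + 1 → ∃ r, C.pos r ∈ Level C S N ∧ C.brush r = c) := by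
    intro π D h hD
    obtain ⟨π', E, r, h1, h2, h3, h4⟩ := hbefore π D h hD
    have h5 : N ≤ total (movesBy r) π' := not_lt.mp fun hlt => hmin r _ hlt h4
    have h6 := total_movesBy_le r π'
    refine ⟨by omega, fun hlen => ⟨r, by rwa [show N = total (movesBy r) π' by omega], ?_⟩⟩
    by_contra hne
    have h7 := h1.one_le_changesBy (b := r) (by rw [h3]; exact Ne.symm hne)
    have h8 := total_le_length (movesBy_add_changesBy_le_one r) π'
    rw [total_add] at h8
    omega
  have hfree : ∀ {b π D}, Run C π D → D.pos b ∈ S →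
      π.length ≤ total (movesBy b) π + total (changesBy b) π → D.Free τ := by
    intro b π D h hb hlen
    obtain ⟨hpos, hpaint⟩ := h.of_all_by hlen
    refine ⟨by rw [hpaint]; exact hτ.1, fun r => ?_⟩
    by_cases hr : r = b
    · rw [hr]; exact hb.1.adjacent.ne
    · rw [hpos r hr]; exact hτ.2 r
  have hwalk : ∀ {b π D}, C.pos b ∈ Level C S N → Run C π D → D.pos b ∈ S →
      N ≤ total (movesBy b) π := by
    intro b π D hb h hD
    have := h.pos_mem_level (S := S) (r := b) (k := 0) hD
    rw [zero_add] at this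
    exact not_lt.mp fun hlt => hmin b _ hlt this
  by_cases hright : ∃ b, C.pos b ∈ Level C S N ∧ C.brush b = c
  · obtain ⟨b, hb, hc⟩ := hright
    obtain ⟨t, ht, hlad⟩ := ladder_walk hS hmin hb N le_rfl
    rw [Nat.sub_self] at ht
    refine ⟨N + 1, hlad.succ (fun π D h hD _ => (hlow π D h hD).1) fun π D h hlen hD _ => ?_⟩
    change D.pos b = t at hD
    have hDS : D.pos b ∈ S := hD ▸ ht.1
    have h1 := hwalk hb h hDS
    have h2 : D.brush b = c := by
      by_contra hne
      have h7 := h.one_le_changesBy (b := b) (by rwa [hc])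
      have h8 := total_le_length (movesBy_add_changesBy_le_one b) π
      rw [total_add] at h8
      omega
    exact exists_step_painted hDS.1 h2 (hfree h hDS (by omega))
  -- No nearest robot has the right color, so `hlow` excludes length `N + 1`, and a color change on
  -- arrival is optimal.
  · obtain ⟨t, ht, hlad⟩ := ladder_walk hS hmin hb₀ N le_rfl
    rw [Nat.sub_self] at ht
    have hc : C.brush b₀ ≠ c := fun hc => hright ⟨b₀, hb₀, hc⟩
    have hchange : ∀ π D, Run C π D → D.pos b₀ = t → D.brush b₀ = c →
        N ≤ total (movesBy b₀) π ∧ 1 ≤ total (changesBy b₀) π := fun π D h h1 h2 =>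
      ⟨hwalk hb₀ h (h1 ▸ ht.1), h.one_le_changesBy (by rw [h2]; exact hc.symm)⟩
    have hlad' : Ladder C (N + 1) (.robotAt b₀ t) (.robotHas b₀ c) := by
      refine hlad.succ (fun π D h h1 h2 => ?_) fun π D h _ h1 _ => exists_step_robotHas c h1
      have h3 := hchange π D h h1 h2
      have h8 := total_le_length (movesBy_add_changesBy_le_one b₀) π
      rw [total_add] at h8
      omega
    refine ⟨N + 2, hlad'.succ (fun π D h hD _ => ?_) fun π D h hlen h1 h2 => ?_⟩
    · have h3 := hlow π D h hD
      rcases h3.1.lt_or_eq with h4 | h4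
      · exact h4
      · exact absurd (h3.2 h4.symm) hright
    · have h3 := hchange π D h h1 h2
      change D.pos b₀ = t at h1
      have hDS : D.pos b₀ ∈ S := h1 ▸ ht.1
      exact exists_step_painted hDS.1 h2 (hfree h hDS (by omega))

end Floortile.Task.Config

/-! ### Painting a tile with a robot on it -/

namespace Floortile.Task.Config

variable {I : Task} {C D : Config I} {π : List I.Act}

/-- The tiles that are clear. -/
def holes (C : Config I) : Set I.Tile := {x | C.Free x}

/-- The distance to the clear tiles bounds the number of moves from below: after `j` moves, the
tiles without robots have distance at most `j`. -/
theorem Run.holes_level (h : Run C π D) :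
    (∀ x, C.paint x = none → (∀ r, D.pos r ≠ x) → x ∈ Level C C.holes (total moves π)) ∧
    ∀ r, D.pos r ≠ C.pos r → C.pos r ∈ Level C C.holes (total moves π) ∧
      ∃ k < total moves π, D.pos r ∈ Level C C.holes k := by
  induction h with
  | nil => exact ⟨fun x hx hr => ⟨hx, hr⟩, fun r hr => absurd rfl hr⟩
  | @snoc π D a D' h hs ih =>
    rw [total_concat]
    cases a with
    | paint => rw [hs.2.2.2.1]; exact ih
    | changeColor => rw [hs.2.1]; exact ih
    | move b t t' hadj =>
      obtain ⟨rfl, hfree, hp, -, -⟩ := hs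
      have ht' : t' ∈ Level C C.holes (total moves π) :=
        ih.1 t' (h.paint_eq_none hfree.1) hfree.2
      have ht : D.pos b ∈ Level C C.holes (total moves π + 1) :=
        .inr ⟨h.paint_eq_none (D.paint_pos b), t', ht', hadj⟩
      rw [hp]
      refine ⟨fun x hx hr => ?_, fun r hr => ?_⟩
      · by_cases hxb : x = D.pos b
        · exact hxb ▸ ht
        · refine .inl (ih.1 x hx fun r hrx => ?_)
          by_cases hrb : r = b
          · exact hxb (hrb ▸ hrx.symm)
          · exact hr r (by rw [Function.update_of_ne hrb, hrx])
      · by_cases hrb : r = b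
        · subst hrb
          rw [Function.update_self]
          refine ⟨?_, _, Nat.lt_succ_self _, ht'⟩
          by_cases hD : D.pos r = C.pos r
          · exact hD ▸ ht
          · exact .inl (ih.2 r hD).1
        · rw [Function.update_of_ne hrb] at hr ⊢
          obtain ⟨h1, k, hk, h2⟩ := ih.2 r hr
          exact ⟨.inl h1, k, Nat.lt_succ_of_lt hk, h2⟩

/-- A robot that could not leave its tile with fewer moves has left it with the last move. -/
theorem Run.last_move (h : Run C π D) {r : I.Robot} (hr : D.pos r ≠ C.pos r)
    (hl : ∀ k < total moves π, C.pos r ∉ Level C C.holes k) :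
    (∀ r', D.pos r' ≠ C.pos r) ∧ I.Adjacent (C.pos r) (D.pos r) ∧
    ∀ r' ≠ r, D.pos r' ≠ C.pos r' → (∃ k, k + 1 < total moves π ∧ D.pos r' ∈ Level C C.holes k) ∧
      ∃ k < total moves π, C.pos r' ∈ Level C C.holes k := by
  induction h with
  | nil => exact absurd rfl hr
  | @snoc π D a D' h hs ih =>
    rw [total_concat] at hl ⊢
    cases a with
    | paint => rw [hs.2.2.2.1] at hr ⊢; exact ih hr hl
    | changeColor => rw [hs.2.1] at hr ⊢; exact ih hr hl
    | move b t t' hadj =>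
      obtain ⟨rfl, hfree, hp, -, -⟩ := hs
      -- Had `r` moved earlier, its starting tile would be at a distance from the clear tiles that
      -- `hl` forbids. So this move is its first.
      have hDr : D.pos r = C.pos r := by
        by_contra hne
        exact hl _ (Nat.lt_succ_self _) (h.holes_level.2 r hne).1
      have hrb : r = b := by
        by_contra hne
        rw [hp, Function.update_of_ne hne] at hr
        exact hr hDr
      subst hrb
      rw [hp]
      refine ⟨fun r' => ?_, ?_, fun r' hne hr' => ?_⟩
      · by_cases hne : r' = r
        · rw [hne, Function.update_self, ← hDr]; exact hadj.ne.symm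
        · rw [Function.update_of_ne hne, ← hDr]
          exact fun h => hne (D.pos_injective h)
      · rw [Function.update_self, ← hDr]; exact hadj
      · rw [Function.update_of_ne hne] at hr' ⊢
        obtain ⟨h1, k, hk, h2⟩ := h.holes_level.2 r' hr'
        exact ⟨⟨k, Nat.succ_lt_succ hk, h2⟩, _, Nat.lt_succ_self _, h1⟩

theorem holes_paint (x : I.Tile) (hx : x ∈ C.holes) : C.paint x = none := hx.1

theorem exists_robot_of_atLevel {n : ℕ} {x : I.Tile} (hx : AtLevel C C.holes (n + 1) x) :
    ∃ r, C.pos r = x := by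
  by_contra! hne
  exact hx.2 0 n.succ_pos ⟨paint_eq_none_of_mem_level holes_paint hx.1, hne⟩

theorem total_moves_le (π : List I.Act) : total moves π ≤ π.length :=
  total_le_length moves_le_one π

theorem Run.le_total_moves (h : Run C π D) {n : ℕ} {x : I.Tile} (hx : AtLevel C C.holes n x)
    (hD : D.Free x) : n ≤ total moves π :=
  not_lt.mp fun hlt => hx.2 _ hlt (h.holes_level.1 x (h.paint_eq_none hD.1) hD.2)

theorem Run.le_total_moves_of_pos_ne (h : Run C π D) {n : ℕ} {r : I.Robot}
    (hx : AtLevel C C.holes n (C.pos r)) (hr : D.pos r ≠ C.pos r) : n ≤ total moves π :=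
  not_lt.mp fun hlt => hx.2 _ hlt (h.holes_level.2 r hr).1

/-- If a neighbor of the tile `x` is cleared first, then `x` can be cleared with one more move. -/
theorem ladder_shift {n : ℕ} {r : I.Robot} {y : I.Tile} {q q' : I.Atom}
    (hx : AtLevel C C.holes (n + 1) (C.pos r)) (hadj : I.Adjacent (C.pos r) y)
    (hlad : Ladder C n (.clear y) q)
    (hq : ∀ D D' : Config I, D.pos r = C.pos r → q ∈ D.state →
      Step D (.move r (C.pos r) y hadj) D' → q' ∈ D'.state) :
    Ladder C (n + 1) (.clear (C.pos r)) q' := by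
  refine hlad.succ (fun π D h hD _ => (h.le_total_moves hx hD).trans (total_moves_le π)) ?_
  intro π D h hlen hD hqD
  -- Leaving a tile at distance `n + 1` takes at least `n + 1` moves, too many for this plan.
  have hr : D.pos r = C.pos r := by
    by_contra hne
    have h1 := h.le_total_moves_of_pos_ne hx hne
    have h2 := total_moves_le π
    omega
  obtain ⟨D', hD'⟩ := exists_step_move D hadj hr hD
  refine ⟨_, D', hD', ⟨?_, fun b => ?_⟩, hq D D' hr hqD hD'⟩
  · rw [hD'.2.2.2.2, ← hr]; exact D.paint_pos r
  · rw [hD'.2.2.1]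
    by_cases hb : b = r
    · rw [hb, Function.update_self]; exact hadj.ne.symm
    · rw [Function.update_of_ne hb, ← hr]
      exact fun h => hb (D.pos_injective h)

/-- A tile is cleared by moving all robots on a shortest path to a clear tile. -/
theorem ladder_clear (b : I.Robot) {n : ℕ} {x : I.Tile} (hx : AtLevel C C.holes n x) :
    Ladder C n (.clear x) (.robotHas b (C.brush b)) := by
  induction n generalizing x with
  | zero => exact .zero hx.1 rfl
  | succ n ih =>
    obtain ⟨y, hadj, hy⟩ := hx.exists_adjacent
    obtain ⟨r, rfl⟩ := exists_robot_of_atLevel hx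
    refine ladder_shift hx hadj (ih hy) fun D D' _ hq hs => ?_
    change D'.brush b = C.brush b
    rw [hs.2.2.2.1]; exact hq

/-- A tile is cleared without moving the robot `b`. -/
theorem ladder_clear_stay {b : I.Robot} {n : ℕ} {x : I.Tile} (hx : AtLevel C C.holes n x)
    (hb : ∀ k < n, C.pos b ∉ Level C C.holes k) (hxb : C.pos b ≠ x) :
    Ladder C n (.clear x) (.robotAt b (C.pos b)) := by
  induction n generalizing x with
  | zero => exact .zero hx.1 rfl
  | succ n ih =>
    obtain ⟨y, hadj, hy⟩ := hx.exists_adjacent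
    obtain ⟨r, rfl⟩ := exists_robot_of_atLevel hx
    have hby : C.pos b ≠ y := by
      rintro rfl
      exact hb n n.lt_succ_self hy.1
    refine ladder_shift hx hadj (ih hy (fun k hk => hb k (hk.trans n.lt_succ_self)) hby) ?_
    intro D D' _ hq hs
    change D'.pos b = C.pos b
    rw [hs.2.2.1, Function.update_of_ne]
    · exact hq
    · rintro rfl; exact hxb rfl

/-- Lower bounds for painting a tile with a robot on it, and how they are attained. -/
theorem Run.length_of_occupied (h : Run C π D) {n : ℕ} {a : I.Robot} {c : Color}
    (hτ : AtLevel C C.holes (n + 1) (C.pos a)) (hD : D.paint (C.pos a) = some c) :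
    n + 2 ≤ π.length ∧ (π.length = n + 2 →
      (∃ b y, I.Vertical (C.pos b) (C.pos a) ∧ C.brush b = c ∧ I.Adjacent (C.pos a) y ∧
        y ∈ Level C C.holes n ∧ C.pos b ≠ y) ∨
      C.brush a = c ∧ ∃ t, I.Vertical t (C.pos a) ∧ t ∈ Level C C.holes n) := by
  obtain ⟨π', E, r, hE, hlen, hv, hc, hfree⟩ := h.exists_before_paint (C.paint_pos a) hD
  have h1 := hE.le_total_moves hτ hfree
  have h2 := total_moves_le π'
  refine ⟨by omega, fun h3 => ?_⟩
  have hmoves : total moves π' = n + 1 := by omega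
  obtain ⟨-, hbrush⟩ := hE.of_moves (by omega)
  rw [hbrush] at hc
  have hl : ∀ k < total moves π', C.pos a ∉ Level C C.holes k := by
    rw [hmoves]; exact hτ.2
  obtain ⟨-, hadj, hother⟩ := hE.last_move (hfree.2 a) hl
  obtain ⟨k, hk, hEa⟩ := (hE.holes_level.2 a (hfree.2 a)).2
  replace hEa := level_mono (by omega : k ≤ n) hEa
  by_cases hra : r = a
  · subst hra
    exact .inr ⟨hc, _, hv, hEa⟩
  -- A robot other than `a` that had moved would now be at distance less than `n` from the clear
  -- tiles; being next to the tile of `a`, it would bring that tile within distance `n`.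
  · have hr : E.pos r = C.pos r := by
      by_contra hne
      obtain ⟨⟨k, hk, hEr⟩, -⟩ := hother r hra hne
      exact hτ.2 (k + 1) (by omega) (.inr ⟨C.paint_pos a, _, hEr, hv.adjacent.symm⟩)
    rw [hr] at hv
    refine .inl ⟨r, _, hv, hc, hadj, hEa, ?_⟩
    rw [← hr]
    exact fun h => hra (E.pos_injective h)

/-- A tile with a robot on it can be painted after the robot has made way. -/
theorem exists_ladder_of_occupied {a : I.Robot} {c : Color}
    (hrun : ∃ π D, Run C π D ∧ D.paint (C.pos a) = some c) :
    ∃ n, Ladder C n (.painted (C.pos a) c) (.painted (C.pos a) c) := by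
  obtain ⟨π₀, D₀, hD₀, hpaint₀⟩ := hrun
  obtain ⟨π₁, E, r₀, hE, -, hv₀, -, hfree₀⟩ := hD₀.exists_before_paint (C.paint_pos a) hpaint₀
  obtain ⟨K, -, hτ⟩ := exists_atLevel (hE.holes_level.1 _ (C.paint_pos a) hfree₀.2)
  obtain _ | n := K
  · exact absurd rfl (hτ.1.2 a)
  have hempty : ∀ {π D}, Run C π D → D.pos a ≠ C.pos a → total moves π = n + 1 →
      D.paint = C.paint → D.Free (C.pos a) := by
    intro π D h hne hm hp
    have := h.last_move hne (by rw [hm]; exact hτ.2)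
    exact ⟨by rw [hp]; exact C.paint_pos a, this.1⟩
  -- Three cases. Either a robot with the right color already stands above or below and need not
  -- make way; or the occupant can itself step up or down along a shortest path; or some robot above
  -- or below stays there and changes color.
  by_cases hi : ∃ b y, I.Vertical (C.pos b) (C.pos a) ∧ C.brush b = c ∧ I.Adjacent (C.pos a) y ∧
        y ∈ Level C C.holes n ∧ C.pos b ≠ y
  · obtain ⟨b, y, hv, hc, hadj, hy, hby⟩ := hi
    have hb : ∀ k < n, C.pos b ∉ Level C C.holes k := fun k hk hbk =>
      hτ.2 (k + 1) (by omega) (.inr ⟨C.paint_pos a, _, hbk, hv.adjacent.symm⟩)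
    have hy' : AtLevel C C.holes n y := ⟨hy, fun k hk hyk =>
      hτ.2 (k + 1) (by omega) (.inr ⟨C.paint_pos a, _, hyk, hadj⟩)⟩
    have hlad : Ladder C (n + 1) (.clear (C.pos a)) (.robotAt b (C.pos b)) := by
      refine ladder_shift hτ hadj (ladder_clear_stay hy' hb hby) fun D D' _ hq hs => ?_
      change D'.pos b = C.pos b
      rw [hs.2.2.1, Function.update_of_ne]
      · exact hq
      · rintro rfl; exact hv.adjacent.ne rfl
    refine ⟨n + 2, hlad.succ (fun π D h hD _ => (h.length_of_occupied hτ hD).1) ?_⟩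
    intro π D h hlen hD hb
    change D.pos b = C.pos b at hb
    have h1 := h.le_total_moves hτ hD
    obtain ⟨-, hbrush⟩ := h.of_moves (by omega)
    exact exists_step_painted (b := b) (hb ▸ hv) (by rw [hbrush, hc]) hD
  by_cases hvia : ∃ t, I.Vertical t (C.pos a) ∧ t ∈ Level C C.holes n
  · obtain ⟨t, hv, ht⟩ := hvia
    have hadj := hv.adjacent.symm
    have ht' : AtLevel C C.holes n t := ⟨ht, fun k hk htk =>
      hτ.2 (k + 1) (by omega) (.inr ⟨C.paint_pos a, _, htk, hadj⟩)⟩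
    have hlad : Ladder C (n + 1) (.clear (C.pos a)) (.robotAt a t) := by
      refine ladder_shift hτ hadj (ladder_clear a ht') fun D D' _ _ hs => ?_
      change D'.pos a = t
      rw [hs.2.2.1, Function.update_self]
    by_cases hc : C.brush a = c
    · refine ⟨n + 2, hlad.succ (fun π D h hD _ => (h.length_of_occupied hτ hD).1) ?_⟩
      intro π D h hlen hD hat
      change D.pos a = t at hat
      have h1 := h.le_total_moves hτ hD
      obtain ⟨-, hbrush⟩ := h.of_moves (by omega)
      exact exists_step_painted (b := a) (hat ▸ hv) (by rw [hbrush, hc]) hD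
    -- The next pair must record position and color of `a`, leaving no atom for the tile being
    -- clear. Counting replaces it: the plan has exactly `n + 1` moves and one color change, so
    -- `hempty` applies.
    · have hchange : ∀ π D, Run C π D → D.pos a = t → D.brush a = c → D.pos a ≠ C.pos a ∧
          n + 1 ≤ total moves π ∧ 1 ≤ total (changesBy a) π ∧
          total moves π + total (changesBy a) π ≤ π.length := by
        intro π D h h1 h2
        have hne : D.pos a ≠ C.pos a := h1 ▸ hv.adjacent.ne
        refine ⟨hne, h.le_total_moves_of_pos_ne hτ hne,
          h.one_le_changesBy (by rw [h2]; exact Ne.symm hc), ?_⟩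
        rw [← total_add]
        exact total_le_length (moves_add_changesBy_le_one a) π
      have hlad' : Ladder C (n + 2) (.robotAt a t) (.robotHas a c) := by
        refine hlad.succ (fun π D h h1 h2 => ?_) fun π D h _ _ h1 => exists_step_robotHas c h1
        have := hchange π D h h1 h2
        omega
      refine ⟨n + 3, hlad'.succ (fun π D h hD _ => ?_) fun π D h hlen h1 h2 => ?_⟩
      · have h1 := h.length_of_occupied hτ hD
        rcases h1.1.lt_or_eq with h2 | h2
        · exact h2
        · exact ((h1.2 h2.symm).elim hi fun h => hc h.1).elim
      · obtain ⟨hne, h3, h4, h5⟩ := hchange π D h h1 h2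
        change D.pos a = t at h1
        obtain ⟨hp, -⟩ := h.of_all_moves (b := a) (by omega)
        exact exists_step_painted (b := a) (h1 ▸ hv) h2 (hempty h hne (by omega) hp)
  -- Feasibility of the painting supplies an unpainted tile above or below. It is not clear, since
  -- clear tiles have distance 0, so a robot `b` stands on it. The color of `b` is wrong, as
  -- otherwise `hi` would hold.
  · have hpaint : C.paint (E.pos r₀) = none := hE.paint_eq_none (E.paint_pos r₀)
    obtain ⟨b, hb⟩ : ∃ b, C.pos b = E.pos r₀ := by
      by_contra! hne
      exact hvia ⟨_, hv₀, level_mono n.zero_le ⟨hpaint, hne⟩⟩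
    have hv : I.Vertical (C.pos b) (C.pos a) := hb ▸ hv₀
    have hbl : C.pos b ∉ Level C C.holes n := fun h => hvia ⟨_, hv, h⟩
    obtain ⟨y, hadj, hy⟩ := hτ.exists_adjacent
    have hc : C.brush b ≠ c := fun hc => hi ⟨b, y, hv, hc, hadj, hy.1, fun h => hbl (h ▸ hy.1)⟩
    have hchange : ∀ π D, Run C π D → D.Free (C.pos a) → D.brush b = c →
        n + 1 ≤ total moves π ∧ 1 ≤ total (changesBy b) π ∧
        total moves π + total (changesBy b) π ≤ π.length := by
      intro π D h h1 h2
      refine ⟨h.le_total_moves hτ h1, h.one_le_changesBy (by rw [h2]; exact Ne.symm hc), ?_⟩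
      rw [← total_add]
      exact total_le_length (moves_add_changesBy_le_one b) π
    have hlad : Ladder C (n + 2) (.clear (C.pos a)) (.robotHas b c) := by
      refine (ladder_clear b hτ).succ (fun π D h h1 h2 => ?_) fun π D h _ h1 _ => ?_
      · have := hchange π D h h1 h2
        omega
      · obtain ⟨D', hD'⟩ := exists_step_changeColor D c (a := b) rfl
        refine ⟨_, D', hD', ?_, ?_⟩
        · change D'.paint _ = none ∧ ∀ r, D'.pos r ≠ _
          rw [hD'.2.1, hD'.2.2.2]
          exact h1
        · change D'.brush b = c
          rw [hD'.2.2.1, Function.update_self]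
    refine ⟨n + 3, hlad.succ (fun π D h hD _ => ?_) fun π D h hlen h1 h2 => ?_⟩
    · have h1 := h.length_of_occupied hτ hD
      rcases h1.1.lt_or_eq with h2 | h2
      · exact h2
      · exact ((h1.2 h2.symm).elim hi fun h => hvia h.2).elim
    · obtain ⟨h3, h4, h5⟩ := hchange π D h h1 h2
      change D.Free _ at h1
      have hm : total moves π = n + 1 := by omega
      -- The pair does not record the position of `b`. If `b` had moved, `last_move` would place its
      -- starting tile within distance `n`, against `hbl`.
      have hpos : D.pos b = C.pos b := by
        by_contra hne
        have hl := h.last_move (h1.2 a) (by rw [hm]; exact hτ.2)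
        have hba : b ≠ a := by
          rintro rfl
          exact hv.adjacent.ne rfl
        obtain ⟨-, k, hk, hbk⟩ := hl.2.2 b hba hne
        exact hbl (level_mono (by omega) hbk)
      exact exists_step_painted (b := b) (hpos ▸ hv) h2 h1

/-- If a tile can be painted at all, then a sequence of atom pairs leads to its color. -/
theorem exists_ladder {τ : I.Tile} {c : Color} (hτ : C.paint τ = none)
    (hrun : ∃ π D, Run C π D ∧ D.paint τ = some c) :
    ∃ n, Ladder C n (.painted τ c) (.painted τ c) := by
  by_cases h : ∃ a, C.pos a = τ
  · obtain ⟨a, rfl⟩ := h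
    exact exists_ladder_of_occupied hrun
  · push Not at h
    exact exists_ladder_of_free ⟨hτ, h⟩ hrun

end Floortile.Task.Config

/-! ### Vertical exits and removable tiles -/

namespace PlanningProblem

variable {P : PlanningProblem}

theorem leads_unique {s u u' : P.State} {π : List P.Act} (h : P.Leads s π u)
    (h' : P.Leads s π u') : u = u' := by
  induction π generalizing s with
  | nil => exact Eq.trans h (Eq.symm h')
  | cons a π ih => exact ih h.2 h'.2

end PlanningProblem

namespace Floortile.Task

variable {I : Task}

/-- Steps in the direction `R` lead from the tile through tiles in `U` to a normal tile. -/
inductive Exit (R : I.Tile → I.Tile → Prop) (U : Set I.Tile) : I.Tile → Prop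
  | normal {t} : ¬ I.IsGoalTile t → Exit R U t
  | step {t t'} : t ∈ U → R t t' → Exit R U t' → Exit R U t

theorem exit_iff {R : I.Tile → I.Tile → Prop} {U : Set I.Tile} {t : I.Tile} :
    Exit R U t ↔ ∃ (n : ℕ) (τ : ℕ → I.Tile), τ 0 = t ∧ (∀ i < n, τ i ∈ U) ∧
      ¬ I.IsGoalTile (τ n) ∧ ∀ i < n, R (τ i) (τ (i + 1)) := by
  constructor
  · intro h
    induction h with
    | @normal t ht => exact ⟨0, fun _ => t, rfl, by simp, ht, by simp⟩
    | @step t t' ht hR _ ih =>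
      obtain ⟨n, τ, h0, hU, hn, hs⟩ := ih
      refine ⟨n + 1, fun i => Nat.casesOn i t τ, rfl, ?_, hn, ?_⟩
      · rintro (_ | i) hi
        exacts [ht, hU i (by omega)]
      · rintro (_ | i) hi
        · subst h0; exact hR
        · exact hs i (by omega)
  · rintro ⟨n, τ, rfl, hU, hn, hs⟩
    induction n generalizing τ with
    | zero => exact .normal hn
    | succ n ih =>
      exact .step (hU 0 n.succ_pos) (hs 0 n.succ_pos)
        (ih (fun i => τ (i + 1)) (fun i hi => hU _ (by omega)) hn fun i hi => hs _ (by omega))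

/-- From each tile in `U`, steps up or steps down lead through `U` to a normal tile. -/
def Open (I : Task) (U : Set I.Tile) : Prop := ∀ t ∈ U, Exit I.Up U t ∨ Exit I.Down U t

theorem verticalChains_iff {s : Set I.Atom} : I.VerticalChains s ↔ I.Open (I.unpainted s) := by
  refine forall₂_congr fun t _ => ?_
  rw [exit_iff, exit_iff]
  constructor
  · rintro ⟨n, τ, h0, hU, hn, h | h⟩
    exacts [.inl ⟨n, τ, h0, hU, hn, h⟩, .inr ⟨n, τ, h0, hU, hn, h⟩]
  · rintro (⟨n, τ, h0, hU, hn, h⟩ | ⟨n, τ, h0, hU, hn, h⟩)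
    exacts [⟨n, τ, h0, hU, hn, .inl h⟩, ⟨n, τ, h0, hU, hn, .inr h⟩]

theorem Exit.mono {R : I.Tile → I.Tile → Prop} {U U' : Set I.Tile} (hU : U ⊆ U') {t : I.Tile}
    (h : Exit R U t) : Exit R U' t := by
  induction h with
  | normal ht => exact .normal ht
  | step ht hR _ ih => exact .step (hU ht) hR ih

theorem Up.eq_of_down {x y z : I.Tile} (h : I.Up y x) (h' : I.Down x z) : z = y :=
  Prod.ext (Fin.ext (by have := h.1; have := h'.1; omega)) (h'.2.trans h.2)

theorem Down.eq_of_up {x y z : I.Tile} (h : I.Down y x) (h' : I.Up x z) : z = y :=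
  Prod.ext (Fin.ext (by have := h.1; have := h'.1; omega)) (h'.2.trans h.2)

/-- An exit of `x` in the direction `R'` would lead back to `τ`, which is a goal tile outside `U'`.
So a goal tile `x` has an exit in the direction `R`, and one more step prolongs it to `τ`. -/
theorem exit_of_neighbor {R R' : I.Tile → I.Tile → Prop}
    (hinv : ∀ {x y z}, R y x → R' x z → z = y) {U U' : Set I.Tile} (hU : U' ⊆ U)
    {τ x : I.Tile} (hτ : τ ∈ U) (hτ' : τ ∉ U') (hg : I.IsGoalTile τ) (hx : R τ x)
    (h : I.IsGoalTile x → Exit R U' x ∨ Exit R' U' x) : Exit R U τ := by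
  by_cases hgx : I.IsGoalTile x
  · rcases h hgx with h | h
    · exact .step hτ hx (h.mono hU)
    · cases h with
      | normal hn => exact absurd hgx hn
      | step _ hR h =>
        obtain rfl := hinv hx hR
        cases h with
        | normal hn => exact absurd hg hn
        | step h _ _ => exact absurd h hτ'
  · exact .step hτ hx (.normal hgx)

/-- Among the tiles that can be left in the direction `R`, one that is farthest away in this
direction can be removed. -/
theorem exists_removable {R R' : I.Tile → I.Tile → Prop}
    (hinv : ∀ {x y z}, R' y x → R x z → z = y) {ρ : I.Tile → ℕ} (hρ : ∀ {x y}, R x y → ρ y < ρ x)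
    {U : Set I.Tile} (hU : ∀ t ∈ U, Exit R U t ∨ Exit R' U t) (hex : ∃ t ∈ U, Exit R U t) :
    ∃ t ∈ U, Exit R U t ∧ ∀ x ∈ U \ {t}, Exit R (U \ {t}) x ∨ Exit R' (U \ {t}) x := by
  classical
  obtain ⟨T, ⟨hTU, hT⟩, hmax⟩ :=
    Set.exists_max_image {t | t ∈ U ∧ Exit R U t} ρ (Set.toFinite _) hex
  -- `ρ` strictly drops along `R`, so a path starting at another tile no higher in `ρ` never meets
  -- `T`.
  have havoid : ∀ x, Exit R U x → x ≠ T → ρ x ≤ ρ T → Exit R (U \ {T}) x := by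
    intro x hx
    induction hx with
    | normal hn => exact fun _ _ => .normal hn
    | @step x y hxU hxy _ ih =>
      intro hne hle
      have hlt := hρ hxy
      refine .step ⟨hxU, hne⟩ hxy (ih ?_ (by omega))
      rintro rfl
      omega
  -- If an `R'`-path from `x` meets `T`, the `R`-exit of `T` retraces that path and passes through
  -- `x`.
  have hback : ∀ x, Exit R' U x → Exit R' (U \ {T}) x ∨ Exit R U x := by
    intro x hx
    induction hx with
    | normal hn => exact .inl (.normal hn)
    | @step x y hxU hxy _ ih =>
      by_cases hxT : x = T
      · exact .inr (hxT ▸ hT)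
      · rcases ih with h | h
        · exact .inl (.step ⟨hxU, hxT⟩ hxy h)
        · cases h with
          | normal hn => exact .inl (.step ⟨hxU, hxT⟩ hxy (.normal hn))
          | step _ hR h =>
            obtain rfl := hinv hxy hR
            exact .inr h
  refine ⟨T, hTU, hT, fun x hx => ?_⟩
  rcases (hU x hx.1).elim .inr (hback x) with h | h
  · exact .inr h
  · exact .inl (havoid x h hx.2 (hmax x ⟨hx.1, h⟩))

/-- Some tile of a nonempty open set can be removed, and can be entered vertically. -/
theorem Open.exists_removable {U : Set I.Tile} (hU : I.Open U) (hne : U.Nonempty)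
    (hg : ∀ t ∈ U, I.IsGoalTile t) :
    ∃ τ ∈ U, I.Open (U \ {τ}) ∧ ∃ t, I.Vertical t τ ∧ (t ∈ U ∨ ¬ I.IsGoalTile t) := by
  have hentry : ∀ {R : I.Tile → I.Tile → Prop} {τ}, τ ∈ U → Exit R U τ →
      ∃ t, R τ t ∧ (t ∈ U ∨ ¬ I.IsGoalTile t) := by
    intro R τ hτ h
    cases h with
    | normal hn => exact absurd (hg τ hτ) hn
    | @step _ t _ hR h =>
      refine ⟨t, hR, ?_⟩
      cases h with
      | normal hn => exact .inr hn
      | step h _ _ => exact .inl h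
  by_cases hex : ∃ t ∈ U, Exit I.Down U t
  · obtain ⟨τ, hτ, hex, h⟩ := Task.exists_removable (R' := I.Up) (ρ := fun t => t.1.val)
      Up.eq_of_down (fun h => by have := h.1; omega) (fun t ht => (hU t ht).symm) hex
    obtain ⟨t, ht, ht'⟩ := hentry hτ hex
    exact ⟨τ, hτ, fun x hx => (h x hx).symm, t, .inl ⟨ht.1, ht.2.symm⟩, ht'⟩
  · have hex' : ∃ t ∈ U, Exit I.Up U t := by
      obtain ⟨t, ht⟩ := hne
      exact ⟨t, ht, (hU t ht).resolve_right fun h => hex ⟨t, ht, h⟩⟩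
    obtain ⟨τ, hτ, hex, h⟩ := Task.exists_removable (R' := I.Down)
      (ρ := fun t => I.rows - t.1.val) Down.eq_of_up
      (fun {x y} h => by have := h.1; have := y.1.isLt; omega) hU hex'
    obtain ⟨t, ht, ht'⟩ := hentry hτ hex
    exact ⟨τ, hτ, h, t, .inr ⟨ht.1, ht.2.symm⟩, ht'⟩

/-! ### Optimal plans for the subgoal paint a single tile -/

theorem painted_notMem_pre {x : I.Tile} {c : Color} {a : I.Act} : .painted x c ∉ I.pre a := by
  cases a <;> simp [pre]

/-- Plans stay executable if atoms `painted x c` are removed or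
further atoms are added. -/
theorem leads_of_diff_subset {x : I.Tile} {c : Color} {s s' u : Set I.Atom} {π : List I.Act}
    (h : I.problem.Leads s π u) (hs : s \ {.painted x c} ⊆ s') :
    ∃ u', I.problem.Leads s' π u' ∧ u \ {.painted x c} ⊆ u' := by
  induction π generalizing s s' with
  | nil =>
    obtain rfl : u = s := h
    exact ⟨s', rfl, hs⟩
  | cons a π ih =>
    obtain ⟨hpre, h⟩ := h
    have hs' : I.problem.result a s \ {.painted x c} ⊆ I.problem.result a s' := by
      rintro p ⟨⟨hp, hdel⟩ | hp, hne⟩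
      exacts [.inl ⟨hs ⟨hp, hne⟩, hdel⟩, .inr hp]
    obtain ⟨u', hu', hsub⟩ := ih h hs'
    refine ⟨u', ⟨fun p hp => hs ⟨hpre hp, ?_⟩, hu'⟩, hsub⟩
    rintro rfl
    exact painted_notMem_pre hp

/-- The states in which the tile has the color. -/
def paintedStates (I : Task) (τ : I.Tile) (c : Color) : Set (Set I.Atom) := {s | .painted τ c ∈ s}

/-- Painting another tile adds only a `painted` atom, which is no precondition, and deletes only a
`clear` atom. Omitting it would give a shorter plan. -/
theorem eq_of_paint_mem_optimalPlan {s : Set I.Atom} {τ t x : I.Tile} {c c' : Color} {r : I.Robot}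
    {hv : I.Vertical x t} {π : List I.Act}
    (h : I.problem.IsOptimalPlan s (I.paintedStates τ c) π) (hm : Act.paint r x t c' hv ∈ π) :
    t = τ := by
  by_contra hne
  obtain ⟨π₁, π₂, rfl⟩ := List.append_of_mem hm
  obtain ⟨⟨u, hu, hl⟩, hopt⟩ := h
  obtain ⟨s₁, h1, -, h2⟩ := PlanningProblem.leads_append.mp hl
  obtain ⟨u', h3, hsub⟩ := leads_of_diff_subset (x := t) (c := c') (s' := s₁) h2 (by
    rintro p ⟨⟨hp, -⟩ | hp, hp'⟩
    exacts [hp, absurd hp hp'])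
  have hle : List.length (α := I.Act) (π₁ ++ _ :: π₂) ≤ List.length (α := I.Act) (π₁ ++ π₂) :=
    hopt (π₁ ++ π₂) ⟨u', hsub ⟨hu, fun h => hne ?_⟩,
    PlanningProblem.leads_append.mpr ⟨s₁, h1, h3⟩⟩
  · simp at hle
  · injection h with h1 _
    exact h1.symm

namespace Config

variable {C D : Config I} {π : List I.Act}

theorem Run.unique {D' : Config I} (h : Run C π D) (h' : Run C π D') : D.state = D'.state :=
  PlanningProblem.leads_unique (P := I.problem) (leads_state_iff.mpr ⟨D, rfl, h⟩)
    (leads_state_iff.mpr ⟨D', rfl, h'⟩)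

theorem paint_of_isOptimalPlan {τ : I.Tile} {c : Color}
    (h : I.problem.IsOptimalPlan C.state (I.paintedStates τ c) π) (hD : Run C π D) :
    D.paint τ = some c ∧ ∀ t ≠ τ, D.paint t = C.paint t := by
  refine ⟨?_, fun t ht => hD.paint_eq fun r x c hv hm => ht (eq_of_paint_mem_optimalPlan h hm)⟩
  obtain ⟨u, hu, hl⟩ := h.1
  obtain ⟨D', rfl, hD'⟩ := leads_state_iff.mp hl
  have : Atom.painted τ c ∈ D.state := by rw [hD.unique hD']; exact hu
  exact this

/-- The goal tiles without their prescribed color. -/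
def unpainted (C : Config I) : Set I.Tile := I.unpainted C.state

theorem mem_unpainted {t : I.Tile} :
    t ∈ C.unpainted ↔ I.IsGoalTile t ∧ C.paint t ≠ some (I.goalColor t) := Iff.rfl

theorem unpainted_eq_diff {τ : I.Tile} (h : D.paint τ = some (I.goalColor τ))
    (h' : ∀ t ≠ τ, D.paint t = C.paint t) : D.unpainted = C.unpainted \ {τ} := by
  ext t
  simp only [Set.mem_sdiff, mem_unpainted, Set.mem_singleton_iff]
  by_cases ht : t = τ
  · subst ht; simp [h]
  · simp [h' t ht, ht]

/-- A step paints at most one further tile in its prescribed color. -/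
theorem Step.unpainted_eq {a : I.Act} (h : Step C a D) : D.unpainted = C.unpainted ∨
    ∃ τ ∈ C.unpainted, D.paint τ = some (I.goalColor τ) ∧ D.unpainted = C.unpainted \ {τ} ∧
      ∃ b, I.Vertical (C.pos b) τ := by
  cases a with
  | move =>
    left; ext t; rw [mem_unpainted, mem_unpainted, h.2.2.2.2]
  | changeColor =>
    left; ext t; rw [mem_unpainted, mem_unpainted, h.2.2.2]
  | paint b t τ c hv =>
    obtain ⟨rfl, -, hfree, -, -, hm⟩ := h
    have hother : ∀ t ≠ τ, D.paint t = C.paint t := fun t ht => by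
      rw [hm, Function.update_of_ne ht]
    have hself : D.paint τ = some c := by rw [hm, Function.update_self]
    by_cases hg : I.IsGoalTile τ ∧ c = I.goalColor τ
    · obtain ⟨hg, rfl⟩ := hg
      exact .inr ⟨τ, ⟨hg, fun h => by
        have := hfree.1.symm.trans h
        simp at this⟩, hself, unpainted_eq_diff hself hother, b, hv⟩
    -- Painting a normal tile, or a goal tile in the wrong color, does not change the set.
    · left
      ext t
      rw [mem_unpainted, mem_unpainted]
      by_cases ht : t = τ
      · subst ht
        rw [hself, hfree.1]
        simp only [ne_eq, Option.some.injEq, reduceCtorEq, not_false_eq_true, and_true,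
          and_iff_left_iff_imp]
        exact fun h1 h2 => hg ⟨h1, h2⟩
      · rw [hother t ht]

/-- The painter stands on an unpainted tile, which is normal or still has an exit afterwards;
`exit_of_neighbor` prolongs this to the painted tile. Exits of the other tiles survive because the
set before is larger. -/
theorem Step.open_of_open {a : I.Act} (h : Step C a D) (hD : I.Open D.unpainted) :
    I.Open C.unpainted := by
  obtain heq | ⟨τ, hτ, -, heq, b, hv⟩ := h.unpainted_eq
  · rwa [← heq]
  have hsub : D.unpainted ⊆ C.unpainted := heq ▸ Set.sdiff_subset
  intro t ht
  by_cases htτ : t = τ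
  · subst htτ
    have hnot : t ∉ D.unpainted := by simp [heq]
    have hb : I.IsGoalTile (C.pos b) →
        Exit I.Up D.unpainted (C.pos b) ∨ Exit I.Down D.unpainted (C.pos b) := by
      intro hg
      refine hD _ ?_
      rw [heq]
      refine ⟨⟨hg, fun h => ?_⟩, hv.adjacent.ne⟩
      have := (C.paint_pos b).symm.trans h
      simp at this
    rcases hv with hv | hv
    · exact .inr (exit_of_neighbor (R := I.Down) (R' := I.Up) Down.eq_of_up hsub ht hnot
        ht.1 ⟨hv.1, hv.2.symm⟩
        fun hg => (hb hg).symm)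
    · exact .inl (exit_of_neighbor (R := I.Up) (R' := I.Down) Up.eq_of_down hsub ht hnot
        ht.1 ⟨hv.1, hv.2.symm⟩ hb)
  · have ht' : t ∈ D.unpainted := by rw [heq]; exact ⟨ht, htτ⟩
    exact (hD t ht').imp (.mono hsub) (.mono hsub)

theorem Run.open_of_open (h : Run C π D) (hD : I.Open D.unpainted) : I.Open C.unpainted := by
  induction h with
  | nil => exact hD
  | snoc _ hs ih => exact ih (hs.open_of_open hD)

/-- A plan that changes the set of unpainted tiles has a prefix that removes a single tile. -/
theorem Run.exists_first_paint (h : Run C π D) : D.unpainted = C.unpainted ∨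
    ∃ τ ∈ C.unpainted, ∃ π' E, π' <+: π ∧ Run C π' E ∧ E.paint τ = some (I.goalColor τ) ∧
      E.unpainted = C.unpainted \ {τ} ∧ ∃ π'', Run E π'' D := by
  induction h with
  | nil => exact .inl rfl
  | @snoc π D a D' h hs ih =>
    rcases ih with heq | ⟨τ, hτ, π', E, hpre, hE, hp, hu, π'', h''⟩
    · rcases hs.unpainted_eq with heq' | ⟨τ, hτ, hp, hu, -⟩
      · exact .inl (heq'.trans heq)
      · exact .inr ⟨τ, heq ▸ hτ, _, D', List.prefix_rfl, h.snoc hs, hp, heq ▸ hu, [], .nil⟩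
    · exact .inr ⟨τ, hτ, π', E, hpre.trans (List.prefix_append _ _), hE, hp, hu, _, h''.snoc hs⟩

/-- The states in which less tiles are unpainted than in `C`, and the unpainted tiles can be left
vertically. -/
def subgoal (C : Config I) : Set (Set I.Atom) :=
  {s | (I.unpainted s).ncard < C.unpainted.ncard ∧ I.VerticalChains s}

theorem mem_subgoal_of_unpainted_eq_diff {τ : I.Tile} (hτ : τ ∈ C.unpainted)
    (ho : I.Open (C.unpainted \ {τ})) (h : D.unpainted = C.unpainted \ {τ}) :
    D.state ∈ C.subgoal := by
  refine ⟨?_, verticalChains_iff.mpr (show I.Open D.unpainted from h ▸ ho)⟩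
  change D.unpainted.ncard < _
  rw [h]
  exact Set.ncard_sdiff_singleton_lt_of_mem hτ

theorem isPlan_iff {G : Set (Set I.Atom)} :
    I.problem.IsPlan C.state G π ↔ ∃ D, Run C π D ∧ D.state ∈ G := by
  constructor
  · rintro ⟨s, hs, hl⟩
    obtain ⟨D, rfl, hD⟩ := leads_state_iff.mp hl
    exact ⟨D, hD, hs⟩
  · rintro ⟨D, hD, hs⟩
    exact ⟨_, hs, leads_state_iff.mpr ⟨D, rfl, hD⟩⟩

theorem isPlan_subgoal_of_isOptimalPlan {τ : I.Tile} (hτ : τ ∈ C.unpainted)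
    (ho : I.Open (C.unpainted \ {τ}))
    (h : I.problem.IsOptimalPlan C.state (I.paintedStates τ (I.goalColor τ)) π) :
    I.problem.IsPlan C.state C.subgoal π := by
  obtain ⟨D, hD, -⟩ := isPlan_iff.mp h.1
  obtain ⟨h1, h2⟩ := paint_of_isOptimalPlan h hD
  exact isPlan_iff.mpr ⟨D, hD, mem_subgoal_of_unpainted_eq_diff hτ ho (unpainted_eq_diff h1 h2)⟩

/-- Optimal plans for the subgoal paint a single tile, and the optimal plans for the color of this
tile are optimal plans for the subgoal. -/
theorem exists_tile_of_isOptimalPlan (h : I.problem.IsOptimalPlan C.state C.subgoal π) :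
    ∃ τ ∈ C.unpainted,
      I.problem.IsOptimalPlan C.state (I.paintedStates τ (I.goalColor τ)) π ∧
      ∀ σ, I.problem.IsOptimalPlan C.state (I.paintedStates τ (I.goalColor τ)) σ →
        I.problem.IsOptimalPlan C.state C.subgoal σ := by
  obtain ⟨D, hD, hlt, hv⟩ := isPlan_iff.mp h.1
  obtain heq | ⟨τ, hτ, π', E, hpre, hE, hp, hu, π'', hED⟩ := hD.exists_first_paint
  · exact absurd hlt (by change ¬ D.unpainted.ncard < _; rw [heq]; exact lt_irrefl _)
  have ho : I.Open (C.unpainted \ {τ}) := hu ▸ hED.open_of_open (verticalChains_iff.mp hv)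
  -- The prefix up to the first useful painting already reaches the subgoal, so optimality leaves no
  -- further actions.
  obtain rfl : π' = π := hpre.eq_of_length_le
    (h.2 _ (isPlan_iff.mpr ⟨E, hE, mem_subgoal_of_unpainted_eq_diff hτ ho hu⟩))
  have hplan : I.problem.IsPlan C.state (I.paintedStates τ (I.goalColor τ)) π' :=
    isPlan_iff.mpr ⟨E, hE, hp⟩
  obtain ⟨σ₀, hσ₀⟩ := hplan.exists_isOptimalPlan
  have hle := h.2 _ (isPlan_subgoal_of_isOptimalPlan hτ ho hσ₀)
  have hopt : I.problem.IsOptimalPlan C.state (I.paintedStates τ (I.goalColor τ)) π' :=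
    ⟨hplan, fun σ hσ => hle.trans (hσ₀.2 σ hσ)⟩
  exact ⟨τ, hτ, hopt, fun σ hσ => ⟨isPlan_subgoal_of_isOptimalPlan hτ ho hσ,
    fun σ' hσ' => (hσ.length_eq hopt).trans_le (h.2 σ' hσ')⟩⟩

end Config

end Floortile.Task

/-! ### Existence of a plan for the subgoal -/

namespace Floortile.Task.Config

variable {I : Task} {C D : Config I} {π : List I.Act}

theorem Step.free_of_move {b : I.Robot} {t t' : I.Tile} {h : I.Adjacent t t'}
    (hs : Step C (.move b t t' h) D) : D.Free t := by
  obtain ⟨rfl, -, hp, -, hm⟩ := hs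
  refine ⟨hm ▸ C.paint_pos b, fun r => ?_⟩
  rw [hp]
  by_cases hr : r = b
  · rw [hr, Function.update_self]; exact h.ne.symm
  · rw [Function.update_of_ne hr]
    exact fun h => hr (C.pos_injective h)

theorem Step.free_of_move_of_ne {b : I.Robot} {t t' x : I.Tile} {h : I.Adjacent t t'}
    (hs : Step C (.move b t t' h) D) (hx : C.Free x) (hne : x ≠ t') : D.Free x := by
  obtain ⟨rfl, -, hp, -, hm⟩ := hs
  refine ⟨hm ▸ hx.1, fun r => ?_⟩
  rw [hp]
  by_cases hr : r = b
  · rw [hr, Function.update_self]; exact hne.symm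
  · rw [Function.update_of_ne hr]; exact hx.2 r

theorem Step.pos_of_move {b : I.Robot} {t t' : I.Tile} {h : I.Adjacent t t'}
    (hs : Step C (.move b t t' h) D) : D.pos b = t' := by
  rw [hs.2.2.1, Function.update_self]

theorem Step.run {a : I.Act} (hs : Step C a D) : Run C [a] D := Run.nil.snoc hs

theorem exists_robot_of_not_free {x : I.Tile} (hx : C.paint x = none) (h : ¬ C.Free x) :
    ∃ r, C.pos r = x := by
  by_contra! hne
  exact h ⟨hx, hne⟩

/-- Neighboring tiles that are not painted. -/
def Passage (C : Config I) (x y : I.Tile) : Prop :=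
  I.Adjacent x y ∧ C.paint x = none ∧ C.paint y = none

theorem Passage.symm {x y : I.Tile} (h : C.Passage x y) : C.Passage y x :=
  ⟨h.1.symm, h.2.2, h.2.1⟩

/-- A clear tile can be moved along a path of unpainted tiles. -/
theorem exists_run_free {x y : I.Tile} (h : Relation.ReflTransGen C.Passage x y) (hx : C.Free x) :
    ∃ π D, Run C π D ∧ D.paint = C.paint ∧ D.Free y := by
  induction h with
  | refl => exact ⟨[], C, .nil, rfl, hx⟩
  | @tail y z _ hyz ih =>
    obtain ⟨π, D, hD, hm, hy⟩ := ih
    by_cases hz : D.Free z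
    · exact ⟨π, D, hD, hm, hz⟩
    · obtain ⟨r, hr⟩ := exists_robot_of_not_free (hm ▸ hyz.2.2) hz
      obtain ⟨E, hE⟩ := exists_step_move D hyz.1.symm hr hy
      exact ⟨_, E, hD.snoc hE, hE.2.2.2.2.trans hm, hE.free_of_move⟩

/-- If `T` is clear, then some robot can walk to the neighboring tile `t` such that `T` is clear in
the end. -/
theorem exists_run_at {T t z : I.Tile} (hT : C.Passage T t)
    (h : Relation.ReflTransGen C.Passage z t) (hm : D.paint = C.paint) (hz : ∃ r, D.pos r = z)
    (hD : D.Free T ∨ z = T ∧ D.Free t) :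
    ∃ π E, Run D π E ∧ (∃ r, E.pos r = t) ∧ E.Free T := by
  induction h using Relation.ReflTransGen.head_induction_on generalizing D with
  | refl =>
    rcases hD with hD | ⟨rfl, -⟩
    · exact ⟨[], D, .nil, hz, hD⟩
    · exact absurd rfl hT.1.ne
  | @head z w hzw _ ih =>
    obtain ⟨r, rfl⟩ := hz
    rcases hD with hD | ⟨rfl, hD⟩
    · by_cases ht : D.Free t
      · by_cases hw : D.Free w
        · obtain ⟨E, hE⟩ := exists_step_move D hzw.1 rfl hw
          have hE' : E.Free T ∨ w = T ∧ E.Free t := by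
            by_cases hwT : w = T
            · exact .inr ⟨hwT, hE.free_of_move_of_ne ht (hwT ▸ hT.1.ne.symm)⟩
            · exact .inl (hE.free_of_move_of_ne hD (Ne.symm hwT))
          obtain ⟨π, F, hF, h⟩ := ih (hE.2.2.2.2.trans hm) ⟨r, hE.pos_of_move⟩ hE'
          exact ⟨_, F, hE.run.trans hF, h⟩
        -- If the next tile is occupied, the robot on it takes over the walk.
        · exact ih hm (exists_robot_of_not_free (hm ▸ hzw.2.2) hw) (.inl hD)
      · exact ⟨[], D, .nil, exists_robot_of_not_free (hm ▸ hT.2.2) ht, hD⟩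
    -- A walker that has come to stand on `T` itself steps directly to the clear neighbor `t`, which
    -- clears `T`.
    · obtain ⟨E, hE⟩ := exists_step_move D hT.1 rfl hD
      exact ⟨_, E, hE.run, ⟨r, hE.pos_of_move⟩, hE.free_of_move⟩

/-- Only goal tiles are painted, and only in their prescribed colors. -/
def Proper (C : Config I) : Prop :=
  ∀ t c, C.paint t = some c → I.IsGoalTile t ∧ c = I.goalColor t

theorem Proper.paint_eq_none (hC : C.Proper) {t : I.Tile}
    (ht : t ∈ C.unpainted ∨ ¬ I.IsGoalTile t) : C.paint t = none := by
  by_contra hne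
  obtain ⟨c, hc⟩ := Option.ne_none_iff_exists'.mp hne
  obtain ⟨hg, rfl⟩ := hC t c hc
  exact ht.elim (fun h => h.2 hc) fun h => h hg

theorem mem_unpainted_or {t : I.Tile} (ht : C.paint t = none) :
    t ∈ C.unpainted ∨ ¬ I.IsGoalTile t := by
  by_cases hg : I.IsGoalTile t
  · exact .inl ⟨hg, fun h => absurd (ht.symm.trans h) (by simp)⟩
  · exact .inr hg

theorem Proper.reach_normal (hC : C.Proper) {R : I.Tile → I.Tile → Prop}
    (hR : ∀ {x y}, R x y → I.Adjacent x y) {t : I.Tile} (ht : Exit R C.unpainted t) :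
    C.paint t = none ∧ ∃ z, ¬ I.IsGoalTile z ∧ Relation.ReflTransGen C.Passage t z := by
  induction ht with
  | @normal t ht => exact ⟨hC.paint_eq_none (.inr ht), t, ht, .refl⟩
  | step ht hxy _ ih =>
    have hp := hC.paint_eq_none (.inl ht)
    obtain ⟨h1, z, hz, h2⟩ := ih
    exact ⟨hp, z, hz, .head ⟨hR hxy, hp, h1⟩ h2⟩

/-- The unpainted part of the grid is connected. -/
theorem Proper.connected (hC : C.Proper) (hn : I.NormalTilesConnected) (ho : I.Open C.unpainted)
    {x y : I.Tile} (hx : C.paint x = none) (hy : C.paint y = none) :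
    Relation.ReflTransGen C.Passage x y := by
  have hreach : ∀ {t}, C.paint t = none →
      ∃ z, ¬ I.IsGoalTile z ∧ Relation.ReflTransGen C.Passage t z := by
    intro t ht
    rcases mem_unpainted_or ht with h | h
    · rcases ho t h with h | h
      · exact (hC.reach_normal (fun h => .inl h) h).2
      · exact (hC.reach_normal (fun h => .inr (.inl h)) h).2
    · exact ⟨t, h, .refl⟩
  have hnormal : ∀ {z z'}, ¬ I.IsGoalTile z → ¬ I.IsGoalTile z' →
      Relation.ReflTransGen C.Passage z z' := by
    intro z z' hz hz'
    have hpath := hn z z' hz hz'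
    clear hz'
    suffices Relation.ReflTransGen C.Passage z z' ∧ ¬ I.IsGoalTile z' from this.1
    induction hpath with
    | refl => exact ⟨.refl, hz⟩
    | tail _ h ih =>
      exact ⟨ih.1.tail ⟨h.1, hC.paint_eq_none (.inr ih.2), hC.paint_eq_none (.inr h.2)⟩, h.2⟩
  obtain ⟨z, hz, h1⟩ := hreach hx
  obtain ⟨z', hz', h2⟩ := hreach hy
  have : Std.Symm C.Passage := ⟨fun _ _ h => h.symm⟩
  exact (h1.trans (hnormal hz hz')).trans (Std.Symm.symm _ _ h2)

/-- There is a plan for the subgoal. -/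
theorem Proper.exists_isPlan_subgoal (hC : C.Proper) (hn : I.NormalTilesConnected)
    (ho : I.Open C.unpainted) (hne : C.unpainted.Nonempty) (b : I.Robot)
    (hr : I.robots ≤ {t : I.Tile | ¬ I.IsGoalTile t}.ncard) :
    ∃ π, I.problem.IsPlan C.state C.subgoal π := by
  obtain ⟨T, hT, hoT, t, hv, ht⟩ := ho.exists_removable hne fun t ht => ht.1
  have hTn := hC.paint_eq_none (.inl hT)
  have htn := hC.paint_eq_none ht
  obtain ⟨x, hx⟩ : ∃ x, C.Free x := by
    by_contra! hnot
    -- Without a clear tile, the robots would occupy all normal tiles and `T` as well, one more tile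
    -- than there can be robots.
    have hsub : insert T {t : I.Tile | ¬ I.IsGoalTile t} ⊆ Set.range C.pos := by
      rintro y (rfl | hy)
      · exact exists_robot_of_not_free hTn (hnot _)
      · exact exists_robot_of_not_free (hC.paint_eq_none (.inr hy)) (hnot _)
    have h1 := Set.ncard_le_ncard hsub (Set.toFinite _)
    have hTg : T ∉ {t : I.Tile | ¬ I.IsGoalTile t} := not_not.mpr hT.1
    rw [Set.ncard_insert_of_notMem hTg (Set.toFinite _), ← Set.image_univ] at h1
    have h2 := Set.ncard_image_le (f := C.pos) (Set.toFinite Set.univ)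
    rw [Set.ncard_univ, Nat.card_eq_fintype_card, Fintype.card_fin] at h2
    omega
  obtain ⟨π₁, D, hD, hm, hDT⟩ := exists_run_free (hC.connected hn ho hx.1 hTn) hx
  obtain ⟨π₂, E, hE, ⟨r, hr⟩, hET⟩ := exists_run_at (D := D) (t := t) ⟨hv.adjacent.symm, hTn, htn⟩
    (hC.connected hn ho (hD.paint_eq_none (D.paint_pos b)) htn) hm ⟨b, rfl⟩ (.inl hDT)
  obtain ⟨F, hF⟩ := exists_step_changeColor E (I.goalColor T) (a := r) rfl
  have hFT : F.Free T := by
    change F.paint T = none ∧ ∀ a, F.pos a ≠ T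
    rw [hF.2.1, hF.2.2.2]; exact hET
  obtain ⟨a, F', hF', hp, -⟩ := exists_step_painted (D := F) (b := r) (τ := T)
    (c := I.goalColor T) (by rw [hF.2.1, hr]; exact hv) (by rw [hF.2.2.1, Function.update_self]) hFT
  have hplan : I.problem.IsPlan C.state (I.paintedStates T (I.goalColor T)) _ :=
    isPlan_iff.mpr ⟨F', ((hD.trans hE).snoc hF).snoc hF', hp⟩
  obtain ⟨π, hπ⟩ := hplan.exists_isOptimalPlan
  exact ⟨π, isPlan_subgoal_of_isOptimalPlan hT hoT hπ⟩

end Floortile.Task.Config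

/-! ### From ladders to admissible chains -/

namespace Floortile.Task.Config

variable {I : Task} {C D : Config I} {π : List I.Act}

/-- The states in which both atoms are true. -/
def pairStates (p q : I.Atom) : Set (Set I.Atom) := {s | p ∈ s ∧ q ∈ s}

/-- The states in which all atoms of the tuple are true. -/
def tupleStates (t : Finset I.Atom) : Set (Set I.Atom) := {s | ∀ x ∈ t, x ∈ s}

/-- The optimal plans from a configuration to a set of states. -/
def OptimalFor (C : Config I) (G : Set (Set I.Atom)) (π : List I.Act) : Prop :=
  I.problem.IsOptimalPlan C.state G π

/-- The index is both a lower bound and attained, by extending plans rung by rung. Hence the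
extension property for plans of length `n` is exactly what admissibility asks of optimal plans. -/
theorem Ladder.isOptimalPlan_iff {n : ℕ} {p q : I.Atom} (h : Ladder C n p q) :
    (∃ π, C.OptimalFor (pairStates p q) π) ∧
    ∀ π, C.OptimalFor (pairStates p q) π ↔
      π.length = n ∧ I.problem.IsPlan C.state (pairStates p q) π := by
  suffices h' : (∃ π, I.problem.IsPlan C.state (pairStates p q) π ∧ π.length = n) ∧
      ∀ π, I.problem.IsPlan C.state (pairStates p q) π → n ≤ π.length by
    obtain ⟨⟨σ, hσ, hn⟩, hlow⟩ := h'
    refine ⟨⟨σ, hσ, fun π hπ => hn.trans_le (hlow π hπ)⟩, fun π => ⟨fun hπ => ?_, fun hπ => ?_⟩⟩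
    · exact ⟨le_antisymm (hn ▸ hπ.2 σ hσ) (hlow π hπ.1), hπ.1⟩
    · exact ⟨hπ.2, fun σ hσ => hπ.1.trans_le (hlow σ hσ)⟩
  induction h with
  | zero hp hq => exact ⟨⟨[], isPlan_iff.mpr ⟨C, .nil, hp, hq⟩, rfl⟩, fun _ _ => Nat.zero_le _⟩
  | succ _ hlow hext ih =>
    obtain ⟨⟨σ, hσ, hn⟩, -⟩ := ih
    change List I.Act at σ
    obtain ⟨D, hD, hp, hq⟩ := isPlan_iff.mp hσ
    obtain ⟨a, D', hs, hp', hq'⟩ := hext σ D hD hn hp hq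
    refine ⟨⟨σ ++ [a], isPlan_iff.mpr ⟨D', hD.snoc hs, hp', hq'⟩, ?_⟩, fun π hπ => ?_⟩
    · exact (List.length_append (as := σ)).trans (congrArg (· + 1) hn)
    obtain ⟨E, hE, hp, hq⟩ := isPlan_iff.mp hπ
    exact hlow π E hE hp hq

/-- The atoms of a ladder are an admissible chain, up to the condition on the goal. -/
theorem Ladder.exists_chain {n : ℕ} {p q : I.Atom} (h : Ladder C n p q) :
    ∃ t : ℕ → Finset I.Atom, (∀ i, (t i).card ≤ 2) ∧ tupleStates (t n) = pairStates p q ∧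
      (∀ x ∈ t 0, x ∈ C.state) ∧
      ∀ i < n, ∀ π, C.OptimalFor (tupleStates (t i)) π →
        ∃ a, C.OptimalFor (tupleStates (t (i + 1))) (π ++ [a]) := by
  classical
  have hpair : ∀ p q : I.Atom, tupleStates ({p, q} : Finset I.Atom) =
      pairStates p q := fun p q => by ext s; simp [pairStates, tupleStates]
  induction h with
  | @zero p q hp hq =>
    refine ⟨fun _ => {p, q}, fun _ => Finset.card_le_two, hpair p q, ?_, by simp⟩
    intro x hx
    rcases Finset.mem_insert.mp hx with rfl | hx
    · exact hp
    · exact Finset.mem_singleton.mp hx ▸ hq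
  | @succ n p q p' q' hlad hlow hext ih =>
    obtain ⟨t, hcard, hn, h0, hstep⟩ := ih
    have hold : ∀ i ≤ n, Function.update t (n + 1) {p', q'} i = t i := fun i hi =>
      Function.update_of_ne (by omega) _ _
    have hnew : Function.update t (n + 1) {p', q'} (n + 1) = {p', q'} := Function.update_self ..
    refine ⟨Function.update t (n + 1) {p', q'}, fun i => ?_, ?_, ?_, fun i hi π hπ => ?_⟩
    · rw [Function.update_apply]
      split_ifs
      exacts [Finset.card_le_two, hcard i]
    · rw [hnew, hpair]
    · rw [hold 0 n.zero_le]; exact h0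
    · rw [hold i (by omega)] at hπ
      rcases Nat.lt_succ_iff_lt_or_eq.mp hi with hi | rfl
      · rw [hold (i + 1) hi]; exact hstep i hi π hπ
      · rw [hn] at hπ
        obtain ⟨hlen, hπ⟩ := (hlad.isOptimalPlan_iff.2 π).mp hπ
        obtain ⟨D, hD, hp, hq⟩ := isPlan_iff.mp hπ
        obtain ⟨a, D', hs, hpq⟩ := hext π D hD hlen hp hq
        refine ⟨a, ?_⟩
        rw [hnew, hpair, (hlad.succ hlow hext).isOptimalPlan_iff.2]
        exact ⟨by simp [hlen], isPlan_iff.mpr ⟨D', hD.snoc hs, hpq⟩⟩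

/-- The initial configuration. -/
def initial (I : Task) : Config I := ⟨I.pos, I.brush, I.paint, I.pos_injective, I.paint_pos⟩

theorem state_initial (I : Task) : (initial I).state = I.problem.init := by
  ext p
  cases p with
  | robotAt a t => exact eq_comm
  | robotHas a c => exact eq_comm
  | clear t => exact Iff.rfl
  | painted t c => exact Iff.rfl

theorem mem_goal_iff {s : Set I.Atom} : s ∈ I.problem.goal ↔ I.unpainted s = ∅ := by
  rw [Set.eq_empty_iff_forall_notMem]
  exact forall_congr' fun t => ⟨fun h h' => h'.2 (h h'.1),
    fun h hg => by_contra fun h' => h ⟨hg, h'⟩⟩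

theorem mem_goal_iff_ncard {s : Set I.Atom} :
    s ∈ I.problem.goal ↔ (I.unpainted s).ncard = 0 := by
  rw [mem_goal_iff, Set.ncard_eq_zero (Set.toFinite _)]

end Floortile.Task.Config

/-! ### Well-formedness and the upper bound on the width -/

namespace Floortile

open Floortile.Task Floortile.Task.Config

theorem satisfies_iff {f f' : Sketch.Valuation BoolFeature NumFeature} :
    (∃ r ∈ sketch, r.Satisfies f f') ↔
      f.bool .v ∧ f'.num .g < f.num .g ∧ (f'.bool .v ↔ f.bool .v) := by
  simp only [sketch, Set.mem_singleton_iff, exists_eq_left]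
  constructor
  · rintro ⟨hc, he, hb, -⟩
    exact ⟨hc (.pos .v) (.inl rfl), he (.dec .g) rfl, hb .v (by simp) (by simp) (by simp)⟩
  · rintro ⟨hv, hg, hb⟩
    refine ⟨?_, ?_, fun p _ _ _ => hb, fun n hn _ _ => absurd (by cases n; rfl) hn⟩
    · rintro c (rfl | rfl)
      exacts [hv, Nat.zero_lt_of_lt hg]
    · rintro e rfl
      exact hg

/-- A state is a goal state iff `g = 0`, and the only rule decreases `g` and never increases it. -/
theorem wellFormed_sketch : Sketch.WellFormed problems features sketch := by
  refine ⟨⟨{b | b.isZero .g}, fun i s => mem_goal_iff_ncard⟩, fun b r h => ⟨.g, fun i => ?_, 0, ?_⟩⟩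
  · refine ⟨i, le_rfl, ?_⟩
    rw [Set.mem_singleton_iff.mp (h i).1]
    exact rfl
  · intro j _
    rw [Set.mem_singleton_iff.mp (h j).1]
    simp

/-- What the reachable states have in common: they correspond to configurations in which the sketch
rule applies as long as something is unpainted. -/
structure Invariant (I : Task) (C : Config I) : Prop where
  proper : C.Proper
  isOpen : I.Open C.unpainted
  unpainted_subset : C.unpainted ⊆ (initial I).unpainted

/-- Solvability gives both properties: wrongly painted tiles could never be repaired, and openness
at the goal propagates back to the start. -/
theorem initial_invariant (i : Instance) : Invariant i.1 (initial i.1) := by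
  obtain ⟨I, ⟨π, hπ⟩, -⟩ := i
  rw [← state_initial] at hπ
  obtain ⟨D, hD, hgoal⟩ := isPlan_iff.mp hπ
  refine ⟨fun t c hc => ?_, hD.open_of_open ?_, le_rfl⟩
  · have hg := I.paint_goal t (by change I.paint t = some c at hc; simp [hc])
    refine ⟨hg, ?_⟩
    have h1 : D.paint t = some (I.goalColor t) := hgoal t hg
    exact Option.some.inj ((hD.paint_of_eq_some hc).symm.trans h1)
  · rw [show D.unpainted = ∅ from mem_goal_iff.mp hgoal]
    exact fun t ht => ht.elim

/-- In a goal state every goal tile is painted, so all robots stand on pairwise different normal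
tiles. -/
theorem robots_le (i : Instance) : i.1.robots ≤ {t : i.1.Tile | ¬ i.1.IsGoalTile t}.ncard := by
  obtain ⟨I, ⟨π, hπ⟩, -⟩ := i
  rw [← state_initial] at hπ
  obtain ⟨D, hD, hgoal⟩ := isPlan_iff.mp hπ
  have hsub : D.pos '' Set.univ ⊆ {t : I.Tile | ¬ I.IsGoalTile t} := by
    rintro _ ⟨a, -, rfl⟩ hg
    have h1 : D.paint (D.pos a) = some (I.goalColor (D.pos a)) := hgoal _ hg
    exact absurd ((D.paint_pos a).symm.trans h1) (by simp)
  have h1 := Set.ncard_le_ncard hsub (Set.toFinite _)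
  rw [Set.ncard_image_of_injective _ D.pos_injective, Set.ncard_univ, Nat.card_eq_fintype_card,
    Fintype.card_fin] at h1
  exact h1

theorem exists_robot (i : Instance) (hne : (initial i.1).unpainted.Nonempty) :
    Nonempty i.1.Robot := by
  obtain ⟨I, ⟨π, hπ⟩, hn⟩ := i
  change (initial I).unpainted.Nonempty at hne
  change Nonempty I.Robot
  rw [← state_initial] at hπ
  obtain ⟨D, hD, hgoal⟩ := isPlan_iff.mp hπ
  cases hD with
  | nil =>
    exfalso
    have : (initial I).unpainted = ∅ := mem_goal_iff.mp hgoal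
    exact hne.ne_empty this
  | @snoc _ _ a _ _ _ =>
    cases a with
    | move b => exact ⟨b⟩
    | paint b => exact ⟨b⟩
    | changeColor b => exact ⟨b⟩

theorem subgoals_eq {i : Instance} {C : Config i.1} (ho : i.1.Open C.unpainted) :
    {s' | ∃ r ∈ sketch, s' ∈ Sketch.subgoals (problems i) (features i) r C.state} = C.subgoal := by
  have hv := verticalChains_iff (s := C.state).mpr ho
  refine Set.ext fun s' => satisfies_iff.trans ?_
  exact ⟨fun h => ⟨h.2.1, h.2.2.mpr hv⟩, fun h => ⟨hv, h.1, fun _ => hv, fun _ => h.2⟩⟩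

theorem reachable_invariant {i : Instance} {s : (problems i).State}
    (h : Sketch.Reachable (problems i) (features i) sketch s) :
    ∃ C : Config i.1, s = C.state ∧ Invariant i.1 C := by
  induction h with
  | init => exact ⟨initial i.1, (state_initial i.1).symm, initial_invariant i⟩
  | step s s' r π _ hr hπ hl hs' ih =>
    obtain ⟨C, rfl, hC⟩ := ih
    have heq := subgoals_eq hC.isOpen
    have hr' : Sketch.subgoals (problems i) (features i) r C.state = C.subgoal := by
      rw [← heq]
      ext u
      refine ⟨fun h => ⟨r, hr, h⟩, ?_⟩
      rintro ⟨r', hr', h⟩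
      rwa [Set.mem_singleton_iff.mp hr, ← Set.mem_singleton_iff.mp hr']
    rw [hr'] at hπ
    obtain ⟨τ, hτ, hopt, -⟩ := exists_tile_of_isOptimalPlan hπ
    obtain ⟨D, rfl, hD⟩ := leads_state_iff.mp hl
    obtain ⟨h1, h2⟩ := paint_of_isOptimalPlan hopt hD
    have hu := unpainted_eq_diff h1 h2
    refine ⟨D, rfl, fun t c hc => ?_, ?_, ?_⟩
    · by_cases ht : t = τ
      · subst ht
        exact ⟨hτ.1, Option.some.inj (hc.symm.trans h1)⟩
      · exact hC.proper t c (h2 t ht ▸ hc)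
    · rw [hr'] at hs'
      exact verticalChains_iff.mp hs'.2
    · rw [hu]
      exact Set.sdiff_subset.trans hC.unpainted_subset

theorem width_subproblem_le {i : Instance} {s : (problems i).State}
    (h : Sketch.Reachable (problems i) (features i) sketch s) :
    (Sketch.subproblem (problems i) (features i) sketch s).width ≤ 2 := by
  obtain ⟨C, rfl, hC⟩ := reachable_invariant h
  rcases C.unpainted.eq_empty_or_nonempty with hempty | hne
  · have hC : C.state ∈ i.1.problem.goal := mem_goal_iff.mpr hempty
    have hplan : (Sketch.subproblem (problems i) (features i) sketch C.state).IsPlan C.state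
        (Sketch.subproblem (problems i) (features i) sketch C.state).goal [] :=
      ⟨C.state, Or.inl hC, rfl⟩
    exact (PlanningProblem.width_eq_zero hplan (Nat.zero_le _)).trans_le zero_le
  have hgoal : (Sketch.subproblem (problems i) (features i) sketch C.state).goal = C.subgoal := by
    change i.1.problem.goal ∪ _ = _
    rw [subgoals_eq hC.isOpen]
    -- The goal states of the instance are subgoal states already: they have `g = 0`, and `v` holds
    -- vacuously.
    refine Set.union_eq_self_of_subset_left fun s hs => ⟨?_, ?_⟩
    · rw [mem_goal_iff_ncard.mp hs]
      exact (Set.ncard_pos (Set.toFinite _)).mpr hne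
    · refine verticalChains_iff.mpr fun t ht => ?_
      rw [mem_goal_iff.mp hs] at ht
      exact ht.elim
  obtain ⟨b⟩ := exists_robot i (hne.mono hC.unpainted_subset)
  obtain ⟨_, hplan⟩ := hC.proper.exists_isPlan_subgoal i.2.2 hC.isOpen hne b (robots_le i)
  obtain ⟨π, hπ⟩ := hplan.exists_isOptimalPlan
  obtain ⟨τ, hτ, hopt, hall⟩ := exists_tile_of_isOptimalPlan hπ
  obtain ⟨D, hD, hp⟩ := isPlan_iff.mp hopt.1
  obtain ⟨n, hlad⟩ := exists_ladder (hC.proper.paint_eq_none (.inl hτ)) ⟨π, D, hD, hp⟩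
  obtain ⟨t, hcard, hn, h0, hstep⟩ := hlad.exists_chain
  have hchain :
      (Sketch.subproblem (problems i) (features i) sketch C.state).IsAdmissibleChain n t := by
    refine ⟨h0, fun j hj σ hσ => ?_, fun σ hσ => ?_⟩
    · obtain ⟨a, ha⟩ := hstep j hj σ (Sketch.isOptimalPlan_subproblem.mp hσ)
      exact ⟨a, Sketch.isOptimalPlan_subproblem.mpr ha⟩
    · have hσ' : C.OptimalFor (tupleStates (t n)) σ := Sketch.isOptimalPlan_subproblem.mp hσ
      rw [hn] at hσ'
      rw [hgoal]
      refine Sketch.isOptimalPlan_subproblem.mpr (hall σ ?_)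
      rwa [show pairStates _ _ = i.1.paintedStates τ (i.1.goalColor τ) from
        Set.ext fun s => and_self_iff] at hσ'
  exact hchain.width_le fun j _ => hcard j

end Floortile

/-! ### The lower bound: an instance with two tiles -/

theorem PlanningProblem.le_width {P : PlanningProblem} {w : ℕ} (hs : P.Solvable)
    (hlen : ∀ π, P.IsPlan P.init P.goal π → 1 < π.length)
    (hchain : ∀ m t k, P.IsAdmissibleChain m t → (∀ i ≤ m, (t i).card ≤ k) → w ≤ k) :
    w ≤ P.width := by
  have h1 : ¬ ∃ π, P.IsPlan P.init P.goal π ∧ π.length ≤ 1 := fun ⟨π, hπ, h⟩ =>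
    absurd (hlen π hπ) (not_lt.mpr h)
  rw [width, if_neg (not_not.mpr hs), if_neg h1]
  refine le_sInf ?_
  rintro _ ⟨k, rfl, m, t, ht, hk⟩
  exact Nat.cast_le.mpr (hchain m t k ht hk)

namespace Floortile

open Floortile.Task Floortile.Task.Config

/-- Two tiles, one above the other. The upper one has to be painted black, and a robot with a white
brush stands on it. -/
def twoTiles : Task where
  rows := 2
  cols := 1
  robots := 1
  rowLo := 1
  rowHi := 2
  colLo := 0
  colHi := 1
  -- The coordinates of the upper tile have an odd sum, so this prescribes black for it.
  evenColor := .white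
  pos := fun _ => (1, 0)
  brush := fun _ => .white
  paint := fun _ => none
  pos_injective := fun a b _ => Subsingleton.elim a b
  paint_pos := fun _ => rfl
  paint_goal := fun _ h => absurd rfl h

namespace twoTiles

def lower : twoTiles.Tile := ((0 : Fin 2), (0 : Fin 1))

def upper : twoTiles.Tile := ((1 : Fin 2), (0 : Fin 1))

def robot : twoTiles.Robot := (0 : Fin 1)

theorem eq_lower_or_eq_upper : ∀ t : twoTiles.Tile, t = lower ∨ t = upper := by
  change ∀ t : Fin 2 × Fin 1, t = ((0 : Fin 2), (0 : Fin 1)) ∨ t = ((1 : Fin 2), (0 : Fin 1))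
  decide

theorem lower_ne_upper : lower ≠ upper := by
  change ((0 : Fin 2), (0 : Fin 1)) ≠ ((1 : Fin 2), (0 : Fin 1))
  decide

theorem eq_robot (a : twoTiles.Robot) : a = robot := Subsingleton.elim (α := Fin 1) _ _

theorem isGoalTile_upper : twoTiles.IsGoalTile upper :=
  ⟨⟨le_rfl, Nat.one_lt_two⟩, le_rfl, Nat.one_pos⟩

theorem not_isGoalTile_lower : ¬ twoTiles.IsGoalTile lower := fun h =>
  absurd h.1.1 (by change ¬ (1 ≤ 0); decide)

theorem goalColor_upper : twoTiles.goalColor upper = .black := by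
  have : ¬ Even (upper.1.val + upper.2.val) := by
    change ¬ Even (1 + 0)
    decide
  rw [goalColor, if_neg this]
  rfl

theorem vertical_lower_upper : twoTiles.Vertical lower upper := .inl ⟨rfl, rfl⟩

theorem mem_goal_iff_paint {C : Config twoTiles} :
    C.state ∈ twoTiles.problem.goal ↔ C.paint upper = some .black := by
  constructor
  · intro h
    have : C.paint upper = some (twoTiles.goalColor upper) := h upper isGoalTile_upper
    rwa [goalColor_upper] at this
  · intro h t ht
    change C.paint t = some (twoTiles.goalColor t)
    rcases eq_lower_or_eq_upper t with rfl | rfl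
    · exact absurd ht not_isGoalTile_lower
    · rw [h, goalColor_upper]

theorem free_lower : (initial twoTiles).Free lower := ⟨rfl, fun _ => lower_ne_upper.symm⟩

/-- The robot moves down. -/
theorem exists_step_down : ∃ a D, Step (initial twoTiles) a D ∧ D.pos robot = lower ∧
    D.Free upper := by
  obtain ⟨D, hD⟩ := exists_step_move (initial twoTiles) (a := robot) (t := upper)
    vertical_lower_upper.adjacent.symm rfl free_lower
  exact ⟨_, D, hD, hD.pos_of_move, hD.free_of_move⟩

theorem exists_plan : ∃ π, twoTiles.problem.IsPlan (initial twoTiles).state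
    twoTiles.problem.goal π := by
  obtain ⟨a, D, hD, hpos, hfree⟩ := exists_step_down
  obtain ⟨E, hE⟩ := exists_step_changeColor D .black (a := robot) rfl
  have hEfree : E.Free upper := by
    change E.paint upper = none ∧ ∀ a, E.pos a ≠ upper
    rw [hE.2.1, hE.2.2.2]; exact hfree
  obtain ⟨b, F, hF, hp, -⟩ := exists_step_painted (D := E) (b := robot) (τ := upper) (c := .black)
    (by rw [hE.2.1, hpos]; exact vertical_lower_upper) (by rw [hE.2.2.1, Function.update_self])
    hEfree
  exact ⟨_, isPlan_iff.mpr ⟨F, (hD.run.snoc hE).snoc hF, mem_goal_iff_paint.mpr hp⟩⟩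

theorem normalTilesConnected : twoTiles.NormalTilesConnected := by
  intro t t' ht ht'
  have h : ∀ t, ¬ twoTiles.IsGoalTile t → t = lower := fun t ht =>
    (eq_lower_or_eq_upper t).resolve_right fun h => ht (h ▸ isGoalTile_upper)
  rw [h t ht, h t' ht']

theorem solvable : twoTiles.problem.Solvable := by
  obtain ⟨π, hπ⟩ := exists_plan
  rw [state_initial] at hπ
  exact ⟨π, hπ⟩

def inst : Instance := ⟨twoTiles, solvable, normalTilesConnected⟩

theorem eq_lower_of_vertical {t : twoTiles.Tile} (h : twoTiles.Vertical t upper) : t = lower :=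
  (eq_lower_or_eq_upper t).resolve_right h.adjacent.ne

/-- Painting the upper tile needs a move and a color change before. -/
theorem two_lt_length {π : List twoTiles.Act} {D : Config twoTiles}
    (h : Run (initial twoTiles) π D) (hD : D.paint upper = some .black) : 2 < π.length := by
  obtain ⟨π', E, r, hE, hlen, hv, hc, -⟩ := h.exists_before_paint rfl hD
  have h1 := hE.one_le_movesBy (b := r) (hv.adjacent.ne)
  have h2 := hE.one_le_changesBy (b := r) (by
    rw [hc]
    intro h
    have : Color.black = Color.white := h
    injection this)
  have h3 := total_le_length (movesBy_add_changesBy_le_one r) π'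
  rw [total_add] at h3
  omega

/-- Immediately before the upper tile is painted, every true atom is also reached by at most one
action. -/
theorem exists_short_run {D : Config twoTiles} {r : twoTiles.Robot}
    (hv : twoTiles.Vertical (D.pos r) upper) (hc : D.brush r = .black) (hf : D.Free upper)
    {q : twoTiles.Atom} (hq : q ∈ D.state) :
    ∃ π E, Run (initial twoTiles) π E ∧ π.length ≤ 1 ∧ q ∈ E.state := by
  have hpos : ∀ a, D.pos a = lower := fun a => by
    rw [eq_robot a, ← eq_robot r]; exact eq_lower_of_vertical hv
  obtain ⟨a, E, hE, hE1, hE2⟩ := exists_step_down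
  cases q with
  | robotAt b t =>
    refine ⟨_, E, hE.run, le_rfl, ?_⟩
    obtain rfl : D.pos b = t := hq
    change E.pos b = D.pos b
    rw [hpos b, eq_robot b, hE1]
  | robotHas b c =>
    obtain rfl : D.brush b = c := hq
    obtain ⟨F, hF⟩ := exists_step_changeColor (initial twoTiles) .black (a := b) rfl
    refine ⟨_, F, hF.run, le_rfl, ?_⟩
    change F.brush b = D.brush b
    rw [hF.2.2.1, Function.update_self, eq_robot b, ← eq_robot r, hc]
  | clear t =>
    refine ⟨_, E, hE.run, le_rfl, ?_⟩
    rcases eq_lower_or_eq_upper t with rfl | rfl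
    · exact absurd (hpos r) (hq.2 r)
    · exact hE2
  | painted t c =>
    exfalso
    have hp : D.paint t = some c := hq
    rcases eq_lower_or_eq_upper t with rfl | rfl
    · rw [← hpos r, D.paint_pos] at hp
      simp at hp
    · rw [hf.1] at hp
      simp at hp

/-- The subproblem of the initial state. -/
noncomputable def sub : PlanningProblem :=
  Sketch.subproblem (problems inst) (features inst) sketch (problems inst).init

theorem mem_sub_goal_iff {C : Config twoTiles} :
    C.state ∈ sub.goal ↔ C.paint upper = some .black := by
  have hgoal : sub.goal = twoTiles.problem.goal ∪ (initial twoTiles).subgoal := by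
    have := subgoals_eq (initial_invariant inst).isOpen
    rw [state_initial] at this
    exact congrArg (twoTiles.problem.goal ∪ ·) this
  rw [← mem_goal_iff_paint, hgoal]
  refine ⟨fun h => h.elim id fun h => ?_, Or.inl⟩
  -- There is only one goal tile, so any decrease of `g` reaches the goal.
  have hsub : (initial twoTiles).unpainted ⊆ {upper} := fun t ht =>
    (eq_lower_or_eq_upper t).resolve_left fun h => not_isGoalTile_lower (h ▸ ht.1)
  have h1 := Set.ncard_le_ncard hsub (Set.toFinite _)
  rw [Set.ncard_singleton] at h1
  exact mem_goal_iff_ncard.mpr (by have := h.1; omega)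

theorem sub_isPlan_iff {G : Set (Set twoTiles.Atom)} {π : List twoTiles.Act} :
    sub.IsPlan sub.init G π ↔ ∃ D, Run (initial twoTiles) π D ∧ D.state ∈ G := by
  rw [← isPlan_iff, state_initial]
  exact Sketch.isPlan_subproblem

theorem two_le_width : 2 ≤ sub.width := by
  have hlow : ∀ π, sub.IsPlan sub.init sub.goal π → 2 < List.length π := by
    intro π hπ
    obtain ⟨D, hD, hg⟩ := sub_isPlan_iff.mp hπ
    exact two_lt_length hD (mem_sub_goal_iff.mp hg)
  refine PlanningProblem.le_width (w := 2) ?_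
    (fun π hπ => (Nat.lt_succ_self 1).trans (hlow π hπ)) ?_
  · obtain ⟨π, hπ⟩ := exists_plan
    obtain ⟨D, hD, hg⟩ := isPlan_iff.mp hπ
    exact ⟨π, sub_isPlan_iff.mpr ⟨D, hD, mem_sub_goal_iff.mpr (mem_goal_iff_paint.mp hg)⟩⟩
  intro m t k hchain hk
  by_contra! hk2
  obtain ⟨σ, hσ, hσm⟩ := hchain.exists_isOptimalPlanFor m le_rfl
  have hm := hlow σ (hchain.2.2 σ hσ).1
  rw [hσm] at hm
  -- The chain has `m ≥ 3`, so its last but one tuple has optimal plans of length `j ≥ 2`, and the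
  -- action that extends one of them paints the upper tile.
  obtain ⟨j, rfl⟩ : ∃ j, m = j + 1 := ⟨m - 1, by omega⟩
  obtain ⟨π, hπ, hπj⟩ := hchain.exists_isOptimalPlanFor j (Nat.le_succ j)
  obtain ⟨a, ha⟩ := hchain.2.1 j (Nat.lt_succ_self j) π hπ
  have hopt := hchain.2.2 _ ha
  obtain ⟨D, hD, hDt⟩ := sub_isPlan_iff.mp hπ.1
  obtain ⟨D', hD', hg⟩ := sub_isPlan_iff.mp hopt.1
  have hnot : D.paint upper ≠ some .black := by
    intro h
    have h1 : (π ++ [a]).length ≤ π.length :=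
      hopt.2 π (sub_isPlan_iff.mpr ⟨D, hD, mem_sub_goal_iff.mpr h⟩)
    rw [List.length_append, List.length_singleton] at h1
    omega
  obtain ⟨u, hu, hpre, heq⟩ := PlanningProblem.leads_concat.mp (leads_state_iff.mpr ⟨D', rfl, hD'⟩)
  obtain rfl : D.state = u :=
    PlanningProblem.leads_unique (leads_state_iff.mpr ⟨D, rfl, hD⟩) hu
  obtain ⟨E, hE⟩ := exists_step hpre
  rw [hE.result_eq] at heq
  have hEp : E.paint upper = some .black := mem_sub_goal_iff.mp (heq ▸ hg)
  obtain ⟨r, hv, hc, hf⟩ := hE.vertical_of_paint hnot hEp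
  -- A tuple of at most one atom true just before the painting is reached within one action,
  -- contradicting `j ≥ 2`.
  obtain ⟨π', F, hF, hlen, hFt⟩ : ∃ π' F, Run (initial twoTiles) π' F ∧ π'.length ≤ 1 ∧
      ∀ q ∈ t j, q ∈ F.state := by
    rcases (t j).eq_empty_or_nonempty with hempty | ⟨q, hq⟩
    · exact ⟨[], _, .nil, by simp, by simp [hempty]⟩
    · obtain ⟨π', F, hF, hlen, hqF⟩ := exists_short_run hv hc hf (hDt q hq)
      refine ⟨π', F, hF, hlen, fun q' hq' => ?_⟩
      rw [Finset.card_le_one.mp (by have := hk j (Nat.le_succ j); omega) q' hq' q hq]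
      exact hqF
  have h1 : List.length (α := twoTiles.Act) π ≤ π'.length :=
    hπ.2 π' (sub_isPlan_iff.mpr ⟨F, hF, hFt⟩)
  have h2 : List.length (α := twoTiles.Act) π = j := hπj
  omega

end twoTiles

end Floortile

theorem theorem2 :
    Sketch.WellFormed Floortile.problems Floortile.features Floortile.sketch ∧
    Sketch.HasWidth Floortile.problems Floortile.features Floortile.sketch 2 := by
  refine ⟨Floortile.wellFormed_sketch, ⟨Floortile.twoTiles.inst, _, .init, ?_⟩, ?_⟩
  · exact le_antisymm Floortile.twoTiles.two_le_width (Floortile.width_subproblem_le .init)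
  · rintro _ ⟨i, s, hs, rfl⟩
    exact Floortile.width_subproblem_le hs
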